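/- **Conventions.** All vector lattices are real and Archimedean; $\mathbb{N}=\{1,2,\dots\}$, $\mathbb{R}^+=[0,\infty)$. For $m\in\mathbb{N}$ let $\mathcal{H}(\mathbb{R}^m)$ be the set of continuous $h:\mathbb{R}^m\to\mathbb{R}$ with $h(\lambda x)=\lambda h(x)$ for all $\lambda\in\mathbb{R}^+$, $x\in\mathbb{R}^m$. Such an $h$ is *absolutely invariant* if $h(x_1,\dots,x_m)=h(|x_1|,\dots,|x_m|)$ for all real $x_1,\dots,x_m$. For $a_1,\dots,a_m,b$ in a vector lattice $E$, write $h(a_1,\dots,a_m)=b$ if $h(\omega(a_1),\dots,\omega(a_m))=\omega(b)$ for every nonzero real-valued vector lattice homomorphism $\omega$ on the vector sublattice of $E$ generated by $a_1,\dots,a_m,b$. For $\mathcal{D}\subseteq\bigcup_{m\in\mathbb{N}}\mathcal{H}(\mathbb{R}^m)$, $E$ is *$\mathcal{D}$-complete* if for all $h\in\mathcal{D}\cap\mathcal{H}(\mathbb{R}^m)$ and $a_1,\dots,a_m\in E$ there is $b\in E$ with $h(a_1,\dots,a_m)=b$. A sequence $(f_n)$ in $E$ *converges relatively uniformly* to $f$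 if there is $p>0$ in $E$ such that for every real $\epsilon>0$ one has $|f_n-f|<\epsilon p$ for all large $n$; it is *relatively uniformly Cauchy* if there is $p>0$ in $E$ such that for every real $\epsilon>0$ one has $|f_m-f_n|<\epsilon p$ for all large $m,n$; $E$ is *uniformly complete* if every relatively uniformly Cauchy sequence in $E$ converges relatively uniformly in $E$. A *uniform completion* of $E$ is a pair $(E^u,\phi)$ of a uniformly complete Archimedean vector lattice $E^u$ and an injective vector lattice homomorphism $\phi:E\to E^u$ such that every vector lattice homomorphism $T$ from $E$ to a uniformly complete Archimedean vector lattice $H$ has the form $T=T^u\circ\phi$ for a unique vector lattice homomorphism $T^u:E^u\to H$. Given $(E^u,\phi)$ and $\mathcal{D}$, let $E_{(1)}=\phi(E)$, let $E_{(n+1)}$ be the vector sublattice of $E^u$ generated by $E_{(n)}$ together with all elements $h(a_1,\dots,a_m)$ of $E^u$ with $h\in\mathcal{D}\cap\mathcal{H}(\mathbb{R}^m)$ and $a_1,\dots,a_m\in E_{(n)}$, and put $E^{\mathcal{D}}=\bigcup_{n\in\mathbb{N}} E_{(n)}$. A map $T:E_1\times\dots\times E_s\to F$ between vector lattices is a *vector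 lattice $s$-morphism* if it is linear in each variable and, for each $k$, the map $f_k\mapsto T(f_1,\dots,f_s)$ is a vector lattice homomorphism whenever $f_j\ge 0$ for all $j\ne k$. **Theorem 3.18.** Let $s\in\mathbb{N}$, let $E_1,\dots,E_s,F$ be Archimedean vector lattices, let $\mathcal{D}\subseteq\bigcup_{m\in\mathbb{N}}\mathcal{H}(\mathbb{R}^m)$ be nonempty, let $F$ be $\mathcal{D}$-complete, and let $T:E_1\times\dots\times E_s\to F$ be a vector lattice $s$-morphism. Then every $E_k$ has a uniform completion, and for any uniform completions $(E_k^u,\phi_k)$ of $E_k$ $(k=1,\dots,s)$, with $E_k^{\mathcal{D}}\subseteq E_k^u$ as above, the following hold. 1. If all elements of $\mathcal{D}$ are absolutely invariant, then there is a unique vector lattice $s$-morphism $T^{\mathcal{D}}:E_1^{\mathcal{D}}\times\dots\times E_s^{\mathcal{D}}\to F$ such that $T^{\mathcal{D}}(\phi_1(f_1),\dots,\phi_s(f_s))=T(f_1,\dots,f_s)$ for all $f_k\in E_k$ $(k=1,\dots,s)$. 2. If $s=1$, then the conclusion of (1) holds without assuming that the elements of $\mathcal{D}$ are absolutely invariant.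 -/

import Mathlib

universe u v

/-! Archimedean vector lattices and their homomorphisms -/

/-- A lattice-ordered real vector space that is Archimedean in the sense of vector lattice theory:
if `0 ≤ x` and `n x ≤ y` for all `n`, then `x = 0`.
(Mathlib's `Archimedean` is the stronger notion for which each positive element is a
strong unit, and is not what is meant here.) -/
class ArchimedeanVectorLattice (E : Type u) [AddCommGroup E] [Lattice E] [Module ℝ E] : Prop
    extends IsOrderedAddMonoid E, PosSMulMono ℝ E where
  eq_zero_of_nsmul_le : ∀ x y : E, 0 ≤ x → (∀ n : ℕ, n • x ≤ y) → x = 0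

/-- A linear map preserving binary suprema and infima. -/
def IsLatticeHom {E : Type u} {F : Type v} [AddCommGroup E] [Lattice E] [Module ℝ E]
    [AddCommGroup F] [Lattice F] [Module ℝ F] (T : E →ₗ[ℝ] F) : Prop :=
  ∀ x y : E, T (x ⊔ y) = T x ⊔ T y ∧ T (x ⊓ y) = T x ⊓ T y

/-- Vector lattice homomorphisms. -/
structure VLHom (E : Type u) (F : Type v) [AddCommGroup E] [Lattice E] [Module ℝ E]
    [AddCommGroup F] [Lattice F] [Module ℝ F] where
  toLin : E →ₗ[ℝ] F
  isLatticeHom : IsLatticeHom toLin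

instance {E : Type u} {F : Type v} [AddCommGroup E] [Lattice E] [Module ℝ E]
    [AddCommGroup F] [Lattice F] [Module ℝ F] : FunLike (VLHom E F) E F where
  coe T := T.toLin
  coe_injective := by
    rintro ⟨S, hS⟩ ⟨T, hT⟩ h
    have : S = T := DFunLike.coe_injective h
    subst this
    rfl

/-- An `s`-linear map that is a vector lattice homomorphism in each variable whenever all the
other variables are fixed at positive elements. -/
def IsVLMultimorphism {s : ℕ} {E : Fin s → Type u} {F : Type v}
    [∀ k, AddCommGroup (E k)] [∀ k, Lattice (E k)] [∀ k, Module ℝ (E k)]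
    [AddCommGroup F] [Lattice F] [Module ℝ F] (T : MultilinearMap ℝ E F) : Prop :=
  ∀ (k : Fin s) (f : ∀ j, E j), (∀ j, j ≠ k → 0 ≤ f j) → IsLatticeHom (T.toLinearMap f k)

/-! Vector sublattices -/

/-- A linear subspace closed under binary suprema and infima. -/
structure VectorSublattice (E : Type u) [AddCommGroup E] [Lattice E] [Module ℝ E]
    extends Submodule ℝ E where
  sup_mem' : ∀ {x y : E}, x ∈ carrier → y ∈ carrier → x ⊔ y ∈ carrier
  inf_mem' : ∀ {x y : E}, x ∈ carrier → y ∈ carrier → x ⊓ y ∈ carrier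

namespace VectorSublattice

variable {E : Type u} [AddCommGroup E] [Lattice E] [Module ℝ E]

instance : SetLike (VectorSublattice E) E where
  coe L := L.carrier
  coe_injective := by
    rintro ⟨L, _, _⟩ ⟨M, _, _⟩ h
    have : L = M := SetLike.coe_injective h
    subst this
    rfl

instance : AddSubgroupClass (VectorSublattice E) E where
  add_mem {L _ _} hx hy := L.toSubmodule.add_mem hx hy
  zero_mem L := L.toSubmodule.zero_mem
  neg_mem {L _} hx := L.toSubmodule.neg_mem hx

instance : SMulMemClass (VectorSublattice E) ℝ E where
  smul_mem {L} r _ hx := L.toSubmodule.smul_mem r hx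

/-- The lattice operations of a vector sublattice are those of the ambient space. -/
instance (L : VectorSublattice E) : Lattice L :=
  Subtype.lattice (fun _ _ hx hy => L.sup_mem' hx hy) (fun _ _ hx hy => L.inf_mem' hx hy)

instance (L : VectorSublattice E) [ArchimedeanVectorLattice E] : ArchimedeanVectorLattice L where
  add_le_add_left a b h c := by
    change (a : E) + c ≤ b + c
    exact add_le_add_left (show (a : E) ≤ b from h) c
  smul_le_smul_of_nonneg_left r hr a b h := by
    change r • (a : E) ≤ r • (b : E)
    exact smul_le_smul_of_nonneg_left (show (a : E) ≤ b from h) hr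
  eq_zero_of_nsmul_le x y hx h :=
    Subtype.ext (ArchimedeanVectorLattice.eq_zero_of_nsmul_le (x : E) y hx h)

/-- The vector sublattice generated by a set: the intersection of all those containing it. -/
def generated (A : Set E) : VectorSublattice E where
  carrier := {x | ∀ L : VectorSublattice E, A ⊆ L → x ∈ L}
  add_mem' hx hy L hL := add_mem (hx L hL) (hy L hL)
  zero_mem' L _ := zero_mem L
  smul_mem' r _ hx L hL := SMulMemClass.smul_mem r (hx L hL)
  sup_mem' hx hy L hL := L.sup_mem' (hx L hL) (hy L hL)
  inf_mem' hx hy L hL := L.inf_mem' (hx L hL) (hy L hL)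

theorem subset_generated (A : Set E) : A ⊆ generated A :=
  fun _ hx _ hL => hL hx

end VectorSublattice

/-- The image of a vector lattice homomorphism. -/
def VLHom.range {E : Type u} {F : Type v} [AddCommGroup E] [Lattice E] [Module ℝ E]
    [AddCommGroup F] [Lattice F] [Module ℝ F] (T : VLHom E F) : VectorSublattice F where
  toSubmodule := LinearMap.range T.toLin
  sup_mem' := by
    rintro _ _ ⟨x, rfl⟩ ⟨y, rfl⟩
    exact ⟨x ⊔ y, (T.isLatticeHom x y).1⟩
  inf_mem' := by
    rintro _ _ ⟨x, rfl⟩ ⟨y, rfl⟩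
    exact ⟨x ⊓ y, (T.isLatticeHom x y).2⟩

/-! Relatively uniform convergence and uniform completions -/

section RelativelyUniform

variable {E : Type u} [AddCommGroup E] [Lattice E] [Module ℝ E]

def RUConverges (f : ℕ → E) (g : E) : Prop :=
  ∃ p : E, 0 < p ∧ ∀ ε : ℝ, 0 < ε → ∃ N : ℕ, ∀ n, N ≤ n → |f n - g| < ε • p

def RUCauchy (f : ℕ → E) : Prop :=
  ∃ p : E, 0 < p ∧ ∀ ε : ℝ, 0 < ε → ∃ N : ℕ, ∀ m n, N ≤ m → N ≤ n → |f m - f n| < ε • p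

end RelativelyUniform

def IsUniformlyComplete (E : Type u) [AddCommGroup E] [Lattice E] [Module ℝ E] : Prop :=
  ∀ f : ℕ → E, RUCauchy f → ∃ g : E, RUConverges f g

/-- `(G, φ)` is a uniform completion of `E`. -/
structure IsUniformCompletion {E G : Type u} [AddCommGroup E] [Lattice E] [Module ℝ E]
    [AddCommGroup G] [Lattice G] [Module ℝ G] (φ : VLHom E G) : Prop where
  archimedean : ArchimedeanVectorLattice G
  uniformlyComplete : IsUniformlyComplete G
  injective : Function.Injective φ
  existsUnique_extension : ∀ (H : Type u) [AddCommGroup H] [Lattice H] [Module ℝ H]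
    [ArchimedeanVectorLattice H], IsUniformlyComplete H →
    ∀ T : VLHom E H, ∃! S : VLHom G H, ∀ x : E, S (φ x) = T x

/-! Functional calculus -/

/-- Continuous, positively homogeneous real functions on `ℝ^m`. -/
structure PosHomFun (m : ℕ) where
  toFun : (Fin m → ℝ) → ℝ
  continuous_toFun : Continuous toFun
  map_smul : ∀ (r : ℝ) (x : Fin m → ℝ), 0 ≤ r → toFun (r • x) = r * toFun x

/-- `h(x₁, …, xₘ) = h(|x₁|, …, |xₘ|)` for all real `x₁, …, xₘ`. -/
def PosHomFun.AbsolutelyInvariant {m : ℕ} (h : PosHomFun m) : Prop :=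
  ∀ x : Fin m → ℝ, h.toFun x = h.toFun (fun i => |x i|)

/-- The disjoint union, over the integers `m ≥ 1`, of the spaces of continuous positively
homogeneous functions on `ℝ^m`. -/
abbrev AnyPosHomFun : Type := Σ m : ℕ+, PosHomFun m

/-- The relation `h(a₁, …, aₘ) = b` in `E`: it holds under every nonzero real-valued vector
lattice homomorphism on the vector sublattice generated by `a₁, …, aₘ, b`. -/
def HasValue {E : Type u} [AddCommGroup E] [Lattice E] [Module ℝ E] {m : ℕ}
    (h : PosHomFun m) (a : Fin m → E) (b : E) : Prop :=
  ∀ ω : VLHom (VectorSublattice.generated (insert b (Set.range a))) ℝ,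
    (∃ x, ω x ≠ 0) →
    h.toFun (fun i => ω ⟨a i, VectorSublattice.subset_generated _ (Or.inr ⟨i, rfl⟩)⟩) =
      ω ⟨b, VectorSublattice.subset_generated _ (Or.inl rfl)⟩

/-- `E` is `D`-complete: `h(a₁, …, aₘ)` exists in `E` for all `h ∈ D` and `a₁, …, aₘ ∈ E`. -/
def IsFunctionallyComplete (D : Set AnyPosHomFun) (E : Type u) [AddCommGroup E] [Lattice E]
    [Module ℝ E] : Prop :=
  ∀ h ∈ D, ∀ a : Fin h.1 → E, ∃ b : E, HasValue h.2 a b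

/-! The `D`-completion inside a uniform completion -/

section Completion

variable {E : Type u} {G : Type v} [AddCommGroup E] [Lattice E] [Module ℝ E]
  [AddCommGroup G] [Lattice G] [Module ℝ G]

/-- Stage `0` is `φ(E)`; stage `n + 1` is the vector sublattice generated by stage `n` and all the
elements `h(a₁, …, aₘ)` with `h ∈ D` and `a₁, …, aₘ` in stage `n`. -/
def completionStage (D : Set AnyPosHomFun) (φ : VLHom E G) : ℕ → VectorSublattice G
  | 0 => φ.range
  | n + 1 => VectorSublattice.generated
      ((completionStage D φ n : Set G) ∪
        {b | ∃ h ∈ D, ∃ a : Fin h.1 → G,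
          (∀ i, a i ∈ completionStage D φ n) ∧ HasValue h.2 a b})

theorem completionStage_mono (D : Set AnyPosHomFun) (φ : VLHom E G) {n m : ℕ} (hnm : n ≤ m)
    {x : G} (hx : x ∈ completionStage D φ n) : x ∈ completionStage D φ m := by
  induction hnm with
  | refl => exact hx
  | step _ ih => exact VectorSublattice.subset_generated _ (Or.inl ih)

/-- The union of the stages; for `φ` the embedding of `E` into its uniform completion this is
the space `E^D`. -/
def functionalCompletion (D : Set AnyPosHomFun) (φ : VLHom E G) : VectorSublattice G where
  carrier := {x | ∃ n, x ∈ completionStage D φ n}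
  add_mem' := by
    rintro x y ⟨n, hn⟩ ⟨m, hm⟩
    exact ⟨max n m, add_mem (completionStage_mono D φ (le_max_left n m) hn)
      (completionStage_mono D φ (le_max_right n m) hm)⟩
  zero_mem' := ⟨0, zero_mem _⟩
  smul_mem' := by
    rintro r x ⟨n, hn⟩
    exact ⟨n, SMulMemClass.smul_mem r hn⟩
  sup_mem' := by
    rintro x y ⟨n, hn⟩ ⟨m, hm⟩
    exact ⟨max n m, (completionStage D φ (max n m)).sup_mem'
      (completionStage_mono D φ (le_max_left n m) hn)
      (completionStage_mono D φ (le_max_right n m) hm)⟩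
  inf_mem' := by
    rintro x y ⟨n, hn⟩ ⟨m, hm⟩
    exact ⟨max n m, (completionStage D φ (max n m)).inf_mem'
      (completionStage_mono D φ (le_max_left n m) hn)
      (completionStage_mono D φ (le_max_right n m) hm)⟩

/-- The map `φ`, regarded as a map from `E` into the functional completion. -/
def toFunctionalCompletion (D : Set AnyPosHomFun) (φ : VLHom E G) (x : E) :
    functionalCompletion D φ :=
  ⟨φ x, 0, x, rfl⟩

end Completion

/-! An Archimedean vector lattice may have no nonzero real-valued homomorphism at all, but the
sublattice generated by countably many of its elements has enough of them (`exists_homOn_ne_zero`).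
So the points used to represent `E` are arbitrary functions `ω : E → ℝ`, looked at along the filter
of those sets that contain every function which is a homomorphism on the sublattice generated by
some fixed countable set. Evaluation then embeds `E` into the germs of real functions along this
filter (`evalGerm_injective`). The filter is closed under countable intersections, so these germs
form an Archimedean uniformly complete vector lattice. They also form a commutative ring with a
pointwise inverse, and the construction is functorial. The relatively uniform closure of `E` in its
germs is a uniform completion.

Positively homogeneous functions act pointwise on germs, and every homomorphism into germs carries
an abstract value `h(a)` to this pointwise value (`HasValue.map_eq_germ`). By induction over the
stages, a homomorphism from `E^D` into germs is determined by its restriction to `E`. If that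
restriction takes its values in a `D`-complete `F`, then so does the whole homomorphism.

For several variables, fix `0 ≤ f ≤ e` coordinatewise. Slices of `T` at comparable positive tuples
are pointwise proportional, which yields in the germs of `F` the product formula `T(f) T(e)^(s-1) =
∏ₖ T(e₁, …, fₖ, …, eₛ)`. Each factor on the right is a homomorphism in one variable and extends to
the uniform completion by functoriality. Dividing by `T(e)^(s-1)`, with zero inverted to zero,
defines the extension on all tuples dominated by `e`; every element of `E^D` is dominated by an
element of `E`, and the result does not depend on `e` (`localExt_eq_of_le`). The extension takes
values in germs, and varying one coordinate at a time shows that they lie in `F`. Uniqueness is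
proved in the same coordinatewise manner. -/

open Filter

set_option linter.unusedSectionVars false

/-! ### Vector lattice arithmetic -/

section Arithmetic

variable {E : Type*} [AddCommGroup E] [Lattice E] [Module ℝ E] [ArchimedeanVectorLattice E]

theorem smul_sup_of_nonneg {r : ℝ} (hr : 0 ≤ r) (x y : E) : r • (x ⊔ y) = r • x ⊔ r • y := by
  rcases hr.eq_or_lt with rfl | hr
  · simp
  apply le_antisymm
  · have h : x ⊔ y ≤ r⁻¹ • (r • x ⊔ r • y) := by
      apply sup_le
      · calc x = r⁻¹ • (r • x) := by rw [smul_smul, inv_mul_cancel₀ hr.ne', one_smul]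
          _ ≤ _ := smul_le_smul_of_nonneg_left le_sup_left (inv_nonneg.2 hr.le)
      · calc y = r⁻¹ • (r • y) := by rw [smul_smul, inv_mul_cancel₀ hr.ne', one_smul]
          _ ≤ _ := smul_le_smul_of_nonneg_left le_sup_right (inv_nonneg.2 hr.le)
    calc r • (x ⊔ y) ≤ r • (r⁻¹ • (r • x ⊔ r • y)) := smul_le_smul_of_nonneg_left h hr.le
      _ = _ := by rw [smul_smul, mul_inv_cancel₀ hr.ne', one_smul]
  · exact sup_le (smul_le_smul_of_nonneg_left le_sup_left hr.le)
      (smul_le_smul_of_nonneg_left le_sup_right hr.le)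

theorem abs_smul_vl (r : ℝ) (x : E) : |r • x| = |r| • |x| := by
  rcases le_total 0 r with hr | hr
  · rw [abs_of_nonneg hr, abs, abs, smul_sup_of_nonneg hr, smul_neg]
  · rw [abs_of_nonpos hr, abs, abs, smul_sup_of_nonneg (neg_nonneg.2 hr), smul_neg, neg_smul,
      neg_neg, sup_comm]

theorem smul_le_smul_right_vl {r t : ℝ} (h : r ≤ t) {x : E} (hx : 0 ≤ x) : r • x ≤ t • x := by
  rw [← sub_nonneg, ← sub_smul]
  exact smul_nonneg (sub_nonneg.2 h) hx

theorem eq_zero_of_le_smul {x p : E} (hx : 0 ≤ x) (h : ∀ ε : ℝ, 0 < ε → x ≤ ε • p) : x = 0 := by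
  apply ArchimedeanVectorLattice.eq_zero_of_nsmul_le x p hx
  intro n
  rcases Nat.eq_zero_or_pos n with rfl | hn
  · have := h 1 one_pos
    rw [one_smul] at this
    simpa using hx.trans this
  · have hn' : (0 : ℝ) < n := Nat.cast_pos.2 hn
    have := smul_le_smul_of_nonneg_left (h (n : ℝ)⁻¹ (inv_pos.2 hn')) hn'.le
    rwa [smul_smul, mul_inv_cancel₀ hn'.ne', one_smul, Nat.cast_smul_eq_nsmul] at this

theorem le_of_forall_le_add_smul {x y p : E} (h : ∀ ε : ℝ, 0 < ε → x ≤ y + ε • p) : x ≤ y := by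
  have h0 : (x - y) ⊔ 0 = 0 := by
    apply eq_zero_of_le_smul (p := p ⊔ 0) le_sup_right
    intro ε hε
    apply sup_le
    · rw [sub_le_iff_le_add']
      exact (h ε hε).trans (add_le_add_right (smul_le_smul_of_nonneg_left le_sup_left hε.le) _)
    · exact smul_nonneg hε.le le_sup_right
  exact sub_nonpos.1 (sup_eq_right.1 h0)

theorem abs_add_le_vl (x y : E) : |x + y| ≤ |x| + |y| := by
  rw [abs]
  refine sup_le (add_le_add (le_abs_self x) (le_abs_self y)) ?_
  rw [neg_add]
  exact add_le_add (neg_le_abs x) (neg_le_abs y)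

theorem abs_sub_le_vl (x y z : E) : |x - z| ≤ |x - y| + |y - z| := by
  have := abs_add_le_vl (x - y) (y - z)
  rwa [sub_add_sub_cancel] at this

omit [Module ℝ E] [ArchimedeanVectorLattice E] in
theorem abs_eq_zero_vl [IsOrderedAddMonoid E] {x : E} : |x| = 0 ↔ x = 0 := by
  constructor
  · intro h
    have h1 : x ≤ 0 := (le_abs_self x).trans h.le
    have h2 : -x ≤ 0 := (neg_le_abs x).trans h.le
    exact le_antisymm h1 (neg_nonpos.1 h2)
  · rintro rfl
    simp [abs]

end Arithmetic

/-! ### Maps that are lattice homomorphisms on a sublattice -/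

namespace VectorSublattice

variable {E : Type*} [AddCommGroup E] [Lattice E] [Module ℝ E]

theorem sup_mem (L : VectorSublattice E) {x y : E} (hx : x ∈ L) (hy : y ∈ L) : x ⊔ y ∈ L :=
  L.sup_mem' hx hy

theorem inf_mem (L : VectorSublattice E) {x y : E} (hx : x ∈ L) (hy : y ∈ L) : x ⊓ y ∈ L :=
  L.inf_mem' hx hy

theorem abs_mem (L : VectorSublattice E) {x : E} (hx : x ∈ L) : |x| ∈ L :=
  L.sup_mem hx (neg_mem hx)

theorem generated_le {A : Set E} {L : VectorSublattice E} (h : A ⊆ L) {x : E}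
    (hx : x ∈ generated A) : x ∈ L := hx L h

theorem generated_mono {A B : Set E} (h : A ⊆ B) {x : E} (hx : x ∈ generated A) :
    x ∈ generated B :=
  generated_le (h.trans (subset_generated B)) hx

end VectorSublattice

/-- `ψ` restricts to a vector lattice homomorphism on `L`. -/
structure HomOn {E R : Type*} [AddCommGroup E] [Lattice E] [Module ℝ E]
    [AddCommGroup R] [Lattice R] [Module ℝ R] (ψ : E → R) (L : VectorSublattice E) : Prop where
  map_add : ∀ x ∈ L, ∀ y ∈ L, ψ (x + y) = ψ x + ψ y
  map_smul : ∀ (r : ℝ), ∀ x ∈ L, ψ (r • x) = r • ψ x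
  map_sup : ∀ x ∈ L, ∀ y ∈ L, ψ (x ⊔ y) = ψ x ⊔ ψ y
  map_inf : ∀ x ∈ L, ∀ y ∈ L, ψ (x ⊓ y) = ψ x ⊓ ψ y

namespace HomOn

variable {E R S : Type*} [AddCommGroup E] [Lattice E] [Module ℝ E]
    [AddCommGroup R] [Lattice R] [Module ℝ R] [AddCommGroup S] [Lattice S] [Module ℝ S]
    {ψ : E → R} {L : VectorSublattice E}

theorem map_zero (h : HomOn ψ L) : ψ 0 = 0 := by
  have := h.map_smul 0 0 (zero_mem L)
  simpa using this

theorem map_neg (h : HomOn ψ L) {x : E} (hx : x ∈ L) : ψ (-x) = -ψ x := by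
  have := h.map_smul (-1) x hx
  simpa using this

theorem map_sub (h : HomOn ψ L) {x y : E} (hx : x ∈ L) (hy : y ∈ L) : ψ (x - y) = ψ x - ψ y := by
  rw [sub_eq_add_neg, h.map_add x hx _ (neg_mem hy), h.map_neg hy, sub_eq_add_neg]

theorem map_abs (h : HomOn ψ L) {x : E} (hx : x ∈ L) : ψ |x| = |ψ x| := by
  rw [abs, abs, h.map_sup x hx _ (neg_mem hx), h.map_neg hx]

theorem map_le (h : HomOn ψ L) {x y : E} (hx : x ∈ L) (hy : y ∈ L) (hxy : x ≤ y) :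
    ψ x ≤ ψ y := by
  have := h.map_sup x hx y hy
  rw [sup_eq_right.2 hxy] at this
  rw [this]
  exact le_sup_left

theorem map_sum (h : HomOn ψ L) {ι : Type*} (s : Finset ι) (f : ι → E) (hf : ∀ i, f i ∈ L) :
    ψ (∑ i ∈ s, f i) = ∑ i ∈ s, ψ (f i) := by
  classical
  induction s using Finset.induction_on with
  | empty => simpa using h.map_zero
  | insert a s ha ih =>
    rw [Finset.sum_insert ha, Finset.sum_insert ha,
      h.map_add _ (hf a) _ (sum_mem fun i _ => hf i), ih]

theorem mono (h : HomOn ψ L) {M : VectorSublattice E} (hM : ∀ x ∈ M, x ∈ L) : HomOn ψ M where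
  map_add x hx y hy := h.map_add x (hM x hx) y (hM y hy)
  map_smul r x hx := h.map_smul r x (hM x hx)
  map_sup x hx y hy := h.map_sup x (hM x hx) y (hM y hy)
  map_inf x hx y hy := h.map_inf x (hM x hx) y (hM y hy)

theorem comp {χ : R → S} {M : VectorSublattice R} (hχ : HomOn χ M) (h : HomOn ψ L)
    (hM : ∀ x ∈ L, ψ x ∈ M) : HomOn (χ ∘ ψ) L where
  map_add x hx y hy := by
    simp only [Function.comp, h.map_add x hx y hy, hχ.map_add _ (hM x hx) _ (hM y hy)]
  map_smul r x hx := by simp only [Function.comp, h.map_smul r x hx, hχ.map_smul r _ (hM x hx)]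
  map_sup x hx y hy := by
    simp only [Function.comp, h.map_sup x hx y hy, hχ.map_sup _ (hM x hx) _ (hM y hy)]
  map_inf x hx y hy := by
    simp only [Function.comp, h.map_inf x hx y hy, hχ.map_inf _ (hM x hx) _ (hM y hy)]

/-- The part of `L` that is mapped into `M`. -/
def preimage (h : HomOn ψ L) (M : VectorSublattice R) : VectorSublattice E where
  carrier := {x | x ∈ L ∧ ψ x ∈ M}
  add_mem' hx hy := ⟨add_mem hx.1 hy.1, by
    rw [h.map_add _ hx.1 _ hy.1]; exact add_mem hx.2 hy.2⟩
  zero_mem' := ⟨zero_mem L, by rw [h.map_zero]; exact zero_mem M⟩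
  smul_mem' r x hx := ⟨SMulMemClass.smul_mem r hx.1, by
    rw [h.map_smul r _ hx.1]; exact SMulMemClass.smul_mem r hx.2⟩
  sup_mem' hx hy := ⟨L.sup_mem hx.1 hy.1, by
    rw [h.map_sup _ hx.1 _ hy.1]; exact M.sup_mem hx.2 hy.2⟩
  inf_mem' hx hy := ⟨L.inf_mem hx.1 hy.1, by
    rw [h.map_inf _ hx.1 _ hy.1]; exact M.inf_mem hx.2 hy.2⟩

/-- The part of `L` on which `ψ` and `ψ'` agree. -/
def eqLocus {ψ' : E → R} (h : HomOn ψ L) (h' : HomOn ψ' L) : VectorSublattice E where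
  carrier := {x | x ∈ L ∧ ψ x = ψ' x}
  add_mem' hx hy := ⟨add_mem hx.1 hy.1, by
    rw [h.map_add _ hx.1 _ hy.1, h'.map_add _ hx.1 _ hy.1, hx.2, hy.2]⟩
  zero_mem' := ⟨zero_mem L, by rw [h.map_zero, h'.map_zero]⟩
  smul_mem' r x hx := ⟨SMulMemClass.smul_mem r hx.1, by
    rw [h.map_smul r _ hx.1, h'.map_smul r _ hx.1, hx.2]⟩
  sup_mem' hx hy := ⟨L.sup_mem hx.1 hy.1, by
    rw [h.map_sup _ hx.1 _ hy.1, h'.map_sup _ hx.1 _ hy.1, hx.2, hy.2]⟩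
  inf_mem' hx hy := ⟨L.inf_mem hx.1 hy.1, by
    rw [h.map_inf _ hx.1 _ hy.1, h'.map_inf _ hx.1 _ hy.1, hx.2, hy.2]⟩

theorem mapsTo_generated {A : Set E} (h : HomOn ψ L) (hA : A ⊆ L) {B : Set R}
    (hB : ∀ x ∈ A, ψ x ∈ VectorSublattice.generated B) {x : E}
    (hx : x ∈ VectorSublattice.generated A) : ψ x ∈ VectorSublattice.generated B :=
  (VectorSublattice.generated_le (L := h.preimage (VectorSublattice.generated B))
    (fun y hy => ⟨hA hy, hB y hy⟩) hx).2

end HomOn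

namespace VLHom

variable {E F : Type*} [AddCommGroup E] [Lattice E] [Module ℝ E]
    [AddCommGroup F] [Lattice F] [Module ℝ F]

theorem homOn (T : VLHom E F) (L : VectorSublattice E) : HomOn T L where
  map_add x _ y _ := T.toLin.map_add x y
  map_smul r x _ := T.toLin.map_smul r x
  map_sup x _ y _ := (T.isLatticeHom x y).1
  map_inf x _ y _ := (T.isLatticeHom x y).2

theorem map_add (T : VLHom E F) (x y : E) : T (x + y) = T x + T y := T.toLin.map_add x y
theorem map_sub (T : VLHom E F) (x y : E) : T (x - y) = T x - T y := T.toLin.map_sub x y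
theorem map_neg (T : VLHom E F) (x : E) : T (-x) = -T x := T.toLin.map_neg x
theorem map_zero (T : VLHom E F) : T 0 = 0 := T.toLin.map_zero
theorem map_smul (T : VLHom E F) (r : ℝ) (x : E) : T (r • x) = r • T x := T.toLin.map_smul r x
theorem map_sup (T : VLHom E F) (x y : E) : T (x ⊔ y) = T x ⊔ T y := (T.isLatticeHom x y).1
theorem map_inf (T : VLHom E F) (x y : E) : T (x ⊓ y) = T x ⊓ T y := (T.isLatticeHom x y).2
theorem map_abs (T : VLHom E F) (x : E) : T |x| = |T x| := by
  rw [abs, abs, T.map_sup, T.map_neg]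
theorem map_le (T : VLHom E F) {x y : E} (h : x ≤ y) : T x ≤ T y :=
  (T.homOn (VectorSublattice.generated Set.univ)).map_le
    (VectorSublattice.subset_generated _ trivial) (VectorSublattice.subset_generated _ trivial) h
theorem map_nonneg (T : VLHom E F) {x : E} (h : 0 ≤ x) : 0 ≤ T x := by
  rw [← T.map_zero]; exact T.map_le h

theorem ext {S T : VLHom E F} (h : ∀ x, S x = T x) : S = T := DFunLike.ext _ _ h

theorem le_of_map_le {T : VLHom E F} (hT : Function.Injective T) {x y : E} (h : T x ≤ T y) :
    x ≤ y := by
  rw [← sup_eq_right] at h ⊢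
  apply hT
  rw [T.map_sup, h]

theorem injective_of_eq_zero {T : VLHom E F} (h : ∀ x, T x = 0 → x = 0) :
    Function.Injective T := by
  intro x y hxy
  rw [← sub_eq_zero]
  apply h
  rw [T.map_sub, hxy, sub_self]

/-- Composition of vector lattice homomorphisms. -/
def comp {G : Type*} [AddCommGroup G] [Lattice G] [Module ℝ G] (S : VLHom F G) (T : VLHom E F) :
    VLHom E G where
  toLin := S.toLin.comp T.toLin
  isLatticeHom x y := by
    constructor
    · change S (T (x ⊔ y)) = _
      rw [T.map_sup, S.map_sup]; rfl
    · change S (T (x ⊓ y)) = _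
      rw [T.map_inf, S.map_inf]; rfl

theorem comp_apply {G : Type*} [AddCommGroup G] [Lattice G] [Module ℝ G] (S : VLHom F G)
    (T : VLHom E F) (x : E) : S.comp T x = S (T x) := rfl

/-- The inverse of an injective homomorphism, composed with a map into its range. -/
theorem exists_factor {G : Type*} [AddCommGroup G] [Lattice G] [Module ℝ G] (S : VLHom E G)
    (J : VLHom F G) (hJ : Function.Injective J) (h : ∀ x, ∃ y, J y = S x) :
    ∃ T : VLHom E F, ∀ x, J (T x) = S x := by
  choose f hf using h
  refine ⟨⟨⟨⟨f, fun x y => hJ ?_⟩, fun r x => hJ ?_⟩, fun x y => ⟨hJ ?_, hJ ?_⟩⟩, hf⟩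
  · rw [J.map_add, hf, hf, hf, S.map_add]
  · change J (f (r • x)) = J (r • f x)
    rw [J.map_smul, hf, hf, S.map_smul]
  · change J (f _) = J (f x ⊔ f y)
    rw [J.map_sup, hf, hf, hf, S.map_sup]
  · change J (f _) = J (f x ⊓ f y)
    rw [J.map_inf, hf, hf, hf, S.map_inf]

end VLHom

namespace VectorSublattice

variable {E R : Type*} [AddCommGroup E] [Lattice E] [Module ℝ E]
    [AddCommGroup R] [Lattice R] [Module ℝ R]

/-- The inclusion of a vector sublattice. -/
def incl (L : VectorSublattice E) : VLHom L E where
  toLin := L.toSubmodule.subtype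
  isLatticeHom _ _ := ⟨rfl, rfl⟩

theorem incl_injective (L : VectorSublattice E) : Function.Injective L.incl :=
  Subtype.val_injective

open Classical in
/-- Extension of a function on `L` by zero. -/
noncomputable def extendZero (L : VectorSublattice E) (f : L → R) (x : E) : R :=
  if h : x ∈ L then f ⟨x, h⟩ else 0

theorem extendZero_apply (L : VectorSublattice E) (f : L → R) {x : E} (h : x ∈ L) :
    L.extendZero f x = f ⟨x, h⟩ := dif_pos h

theorem homOn_extendZero (L : VectorSublattice E) (T : VLHom L R) : HomOn (L.extendZero T) L where
  map_add x hx y hy := by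
    rw [L.extendZero_apply T hx, L.extendZero_apply T hy, L.extendZero_apply T (add_mem hx hy)]
    exact T.map_add ⟨x, hx⟩ ⟨y, hy⟩
  map_smul r x hx := by
    rw [L.extendZero_apply T hx, L.extendZero_apply T (SMulMemClass.smul_mem r hx)]
    exact T.map_smul r ⟨x, hx⟩
  map_sup x hx y hy := by
    rw [L.extendZero_apply T hx, L.extendZero_apply T hy, L.extendZero_apply T (L.sup_mem hx hy)]
    exact T.map_sup ⟨x, hx⟩ ⟨y, hy⟩
  map_inf x hx y hy := by
    rw [L.extendZero_apply T hx, L.extendZero_apply T hy, L.extendZero_apply T (L.inf_mem hx hy)]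
    exact T.map_inf ⟨x, hx⟩ ⟨y, hy⟩

end VectorSublattice

/-- A homomorphism on a vector sublattice, as a bundled map. -/
def HomOn.toVLHom {E R : Type*} [AddCommGroup E] [Lattice E] [Module ℝ E]
    [AddCommGroup R] [Lattice R] [Module ℝ R] {ψ : E → R} {L : VectorSublattice E}
    (h : HomOn ψ L) : VLHom L R where
  toLin :=
    { toFun := fun x => ψ x
      map_add' := fun x y => h.map_add x x.2 y y.2
      map_smul' := fun r x => h.map_smul r x x.2 }
  isLatticeHom x y := ⟨h.map_sup x x.2 y y.2, h.map_inf x x.2 y y.2⟩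

namespace PosHomFun

theorem map_zero {m : ℕ} (h : PosHomFun m) : h.toFun 0 = 0 := by
  have := h.map_smul 0 0 le_rfl
  simpa using this

end PosHomFun

section HasValue

variable {E : Type*} [AddCommGroup E] [Lattice E] [Module ℝ E]

/-- `HasValue` only speaks of nonzero homomorphisms on the generated sublattice. Restriction handles
a larger domain, and for a restriction that vanishes both sides are zero because `h 0 = 0`. -/
theorem HasValue.apply_eq {m : ℕ} {h : PosHomFun m} {a : Fin m → E} {b : E} (hv : HasValue h a b)
    {ω : E → ℝ} {L : VectorSublattice E} (hω : HomOn ω L) (ha : ∀ i, a i ∈ L) (hb : b ∈ L) :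
    ω b = h.toFun fun i => ω (a i) := by
  have hL : ∀ x ∈ VectorSublattice.generated (insert b (Set.range a)), x ∈ L := fun x hx =>
    VectorSublattice.generated_le (by
      rintro _ (rfl | ⟨i, rfl⟩)
      exacts [hb, ha i]) hx
  by_cases hne : ∃ x, (hω.mono hL).toVLHom x ≠ 0
  · exact (hv _ hne).symm
  · push Not at hne
    have hb0 : ω b = 0 := hne ⟨b, VectorSublattice.subset_generated _ (Or.inl rfl)⟩
    have ha0 : ∀ i, ω (a i) = 0 := fun i =>
      hne ⟨a i, VectorSublattice.subset_generated _ (Or.inr ⟨i, rfl⟩)⟩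
    simp only [ha0, hb0]
    exact h.map_zero.symm

end HasValue

/-! ### Enough real-valued homomorphisms on countable sets -/

section Points

variable {E : Type*} [AddCommGroup E] [Lattice E] [Module ℝ E] [ArchimedeanVectorLattice E]

/-- The positive cone of an order ideal. -/
structure IsPosIdeal (P : Set E) : Prop where
  nonneg : ∀ x ∈ P, 0 ≤ x
  zero_mem : (0 : E) ∈ P
  add_mem : ∀ x ∈ P, ∀ y ∈ P, x + y ∈ P
  smul_mem : ∀ r : ℝ, 0 ≤ r → ∀ x ∈ P, r • x ∈ P
  down : ∀ x y, 0 ≤ x → x ≤ y → y ∈ P → x ∈ P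

/-- For positive `x` this is the cone of the ideal generated by `P` and `x`, against which the
maximality of `P` is tested below. -/
theorem IsPosIdeal.adjoin {P : Set E} (hP : IsPosIdeal P) (x : E) :
    IsPosIdeal {z | 0 ≤ z ∧ ∃ i ∈ P, ∃ r : ℝ, 0 ≤ r ∧ z ≤ i + r • x} where
  nonneg z hz := hz.1
  zero_mem := ⟨le_rfl, 0, hP.zero_mem, 0, le_rfl, by simp⟩
  add_mem := by
    rintro y ⟨hy, i, hi, r, hr, h⟩ z ⟨hz, j, hj, t, ht, h'⟩
    refine ⟨add_nonneg hy hz, i + j, hP.add_mem i hi j hj, r + t, add_nonneg hr ht, ?_⟩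
    calc y + z ≤ (i + r • x) + (j + t • x) := add_le_add h h'
      _ = _ := by rw [add_smul]; abel
  smul_mem := by
    rintro c hc y ⟨hy, i, hi, r, hr, h⟩
    refine ⟨smul_nonneg hc hy, c • i, hP.smul_mem c hc i hi, c * r, mul_nonneg hc hr, ?_⟩
    rw [mul_smul, ← smul_add]
    exact smul_le_smul_of_nonneg_left h hc
  down := by
    rintro y z hy hyz ⟨hz, i, hi, r, hr, h⟩
    exact ⟨hy, i, hi, r, hr, hyz.trans h⟩

theorem smul_inf_smul_eq_zero {x y : E} (hx : 0 ≤ x) (hy : 0 ≤ y) (hxy : x ⊓ y = 0) {r t : ℝ}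
    (hr : 0 ≤ r) (ht : 0 ≤ t) : (r • x) ⊓ (t • y) = 0 := by
  set c := max r t
  have hc : 0 ≤ c := hr.trans (le_max_left _ _)
  apply le_antisymm
  · have h1 : c • x ⊓ c • y = 0 := by
      have h2 := smul_sup_of_nonneg hc (-x) (-y)
      rw [← neg_inf, hxy] at h2
      simp only [smul_neg, neg_zero, smul_zero, ← neg_inf] at h2
      exact (neg_eq_zero.1 h2.symm)
    rw [← h1]
    exact inf_le_inf (smul_le_smul_right_vl (le_max_left _ _) hx)
      (smul_le_smul_right_vl (le_max_right _ _) hy)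
  · exact le_inf (smul_nonneg hr hx) (smul_nonneg ht hy)

/-- An ideal maximal among those avoiding a decreasing sequence is prime. If disjoint `x`, `y` both
lay outside, adjoining either would capture some member, giving `e n ≤ i + r x` and `e m ≤ j + t y`.
By monotonicity a single later member satisfies both bounds, hence lies below `i + j + (r x ⊓ t y) =
i + j`, which is in the ideal. -/
theorem exists_prime_posIdeal (e : ℕ → E) (he : Antitone e) (hpos : ∀ n, 0 < e n) :
    ∃ P : Set E, IsPosIdeal P ∧ (∀ n, e n ∉ P) ∧
      ∀ x y : E, 0 ≤ x → 0 ≤ y → x ⊓ y = 0 → x ∈ P ∨ y ∈ P := by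
  obtain ⟨P, hP⟩ := zorn_subset {P : Set E | IsPosIdeal P ∧ ∀ n, e n ∉ P} (by
    intro c hc hchain
    rcases c.eq_empty_or_nonempty with rfl | hne
    · refine ⟨{0}, ⟨⟨?_, ?_, ?_, ?_, ?_⟩, ?_⟩, by simp⟩
      · rintro _ rfl; exact le_rfl
      · exact rfl
      · rintro _ rfl _ rfl; simp
      · rintro r - _ rfl; simp
      · rintro x _ hx hxy rfl; exact le_antisymm hxy hx
      · intro n hn; exact (hpos n).ne' hn
    · refine ⟨⋃₀ c, ⟨⟨?_, ?_, ?_, ?_, ?_⟩, ?_⟩, fun s hs => Set.subset_sUnion_of_mem hs⟩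
      · rintro x ⟨s, hs, hx⟩; exact (hc hs).1.nonneg x hx
      · obtain ⟨s, hs⟩ := hne; exact ⟨s, hs, (hc hs).1.zero_mem⟩
      · rintro x ⟨s, hs, hx⟩ y ⟨t, ht, hy⟩
        rcases hchain.total hs ht with h | h
        · exact ⟨t, ht, (hc ht).1.add_mem x (h hx) y hy⟩
        · exact ⟨s, hs, (hc hs).1.add_mem x hx y (h hy)⟩
      · rintro r hr x ⟨s, hs, hx⟩; exact ⟨s, hs, (hc hs).1.smul_mem r hr x hx⟩
      · rintro x y hx hxy ⟨s, hs, hy⟩; exact ⟨s, hs, (hc hs).1.down x y hx hxy hy⟩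
      · rintro n ⟨s, hs, hn⟩; exact (hc hs).2 n hn)
  refine ⟨P, hP.prop.1, hP.prop.2, ?_⟩
  have hmeet : ∀ x, 0 ≤ x → x ∉ P → ∃ n, ∃ i ∈ P, ∃ r : ℝ, 0 ≤ r ∧ e n ≤ i + r • x := by
    intro x hx hxP
    by_contra! hcon
    have hadj := hP.prop.1.adjoin x
    have := hP.le_of_ge (y := {z | 0 ≤ z ∧ ∃ i ∈ P, ∃ r : ℝ, 0 ≤ r ∧ z ≤ i + r • x})
      ⟨hadj, fun n hn => by
        obtain ⟨-, i, hi, r, hr, h⟩ := hn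
        exact hcon n i hi r hr h⟩
      (fun z hz => ⟨hP.prop.1.nonneg z hz, z, hz, 0, le_rfl, by simp⟩)
    exact hxP (this ⟨hx, 0, hP.prop.1.zero_mem, 1, zero_le_one, by simp⟩)
  intro x y hx hy hxy
  by_contra! hcon
  obtain ⟨n, i, hi, r, hr, h1⟩ := hmeet x hx hcon.1
  obtain ⟨m, j, hj, t, ht, h2⟩ := hmeet y hy hcon.2
  have hi0 := hP.prop.1.nonneg i hi
  have hj0 := hP.prop.1.nonneg j hj
  have key : e (max n m) ≤ i + j := by
    have h3 : e (max n m) ≤ (i + j) + r • x :=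
      (he (le_max_left n m)).trans (h1.trans (by gcongr; exact le_add_of_nonneg_right hj0))
    have h4 : e (max n m) ≤ (i + j) + t • y :=
      (he (le_max_right n m)).trans (h2.trans (by gcongr; exact le_add_of_nonneg_left hi0))
    have h5 := le_inf h3 h4
    rwa [← add_inf, smul_inf_smul_eq_zero hx hy hxy hr ht, add_zero] at h5
  exact hP.prop.2 _ (hP.prop.1.down _ _ (hpos _).le key (hP.prop.1.add_mem i hi j hj))

theorem exists_pos_sub_smul_abs {e : E} (he : 0 < e) (c : E) :
    ∃ k : ℝ, 0 < k ∧ 0 < (e - k • |c|) ⊔ 0 := by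
  by_contra! hcon
  apply he.ne'
  apply eq_zero_of_le_smul (p := |c|) he.le
  intro ε hε
  have h := hcon ε hε
  have h0 : (e - ε • |c|) ⊔ 0 = 0 := by
    by_contra hne
    exact h (lt_of_le_of_ne le_sup_right (Ne.symm hne))
  exact sub_nonpos.1 (sup_eq_right.1 h0)

/-- An ideal that avoids every `u n` and has a totally ordered quotient must satisfy `k |c n| ≤ u n
≤ e` in the quotient, since otherwise `u (n + 1)` would vanish there. Thus every `c n` becomes
bounded by a multiple of `e`. The Archimedean property is what allows each `k` to be chosen with `u
(n + 1)` still nonzero. -/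
theorem exists_antitone_dominating {e : E} (he : 0 < e) (c : ℕ → E) :
    ∃ u : ℕ → E, u 0 = e ∧ Antitone u ∧ (∀ n, 0 < u n) ∧
      ∀ n, ∃ k : ℝ, 0 < k ∧ u (n + 1) = (u n - k • |c n|) ⊔ 0 := by
  let step : ℕ → {x : E // 0 < x} → {x : E // 0 < x} := fun n x =>
    ⟨(x.1 - (exists_pos_sub_smul_abs x.2 (c n)).choose • |c n|) ⊔ 0,
      (exists_pos_sub_smul_abs x.2 (c n)).choose_spec.2⟩
  let w : ℕ → {x : E // 0 < x} := fun n => Nat.rec ⟨e, he⟩ step n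
  refine ⟨fun n => (w n).1, rfl, ?_, fun n => (w n).2, fun n =>
    ⟨_, (exists_pos_sub_smul_abs (w n).2 (c n)).choose_spec.1, rfl⟩⟩
  apply antitone_nat_of_succ_le
  intro n
  change ((w n).1 - _ • |c n|) ⊔ 0 ≤ (w n).1
  refine sup_le (sub_le_self _ ?_) (w n).2.le
  exact smul_nonneg (exists_pos_sub_smul_abs (w n).2 (c n)).choose_spec.1.le (abs_nonneg _)

/-- `x ≤ 0` modulo the ideal. -/
def NegMod (P : Set E) (x : E) : Prop := x ⊔ 0 ∈ P

namespace NegMod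

variable {P : Set E}

theorem mono (hP : IsPosIdeal P) {x y : E} (hxy : x ≤ y) (hy : NegMod P y) : NegMod P x :=
  hP.down _ _ le_sup_right (sup_le_sup_right hxy 0) hy

theorem add (hP : IsPosIdeal P) {x y : E} (hx : NegMod P x) (hy : NegMod P y) :
    NegMod P (x + y) :=
  hP.down _ _ le_sup_right (sup_le (add_le_add le_sup_left le_sup_left)
    (add_nonneg le_sup_right le_sup_right)) (hP.add_mem _ hx _ hy)

theorem smul (hP : IsPosIdeal P) {r : ℝ} (hr : 0 ≤ r) {x : E} (hx : NegMod P x) :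
    NegMod P (r • x) := by
  have := hP.smul_mem r hr _ hx
  rwa [smul_sup_of_nonneg hr, smul_zero] at this

theorem sup (hP : IsPosIdeal P) {x y : E} (hx : NegMod P x) (hy : NegMod P y) :
    NegMod P (x ⊔ y) := by
  refine hP.down _ _ le_sup_right (sup_le (sup_le ?_ ?_) ?_) (hP.add_mem _ hx _ hy)
  · exact le_add_of_le_of_nonneg le_sup_left le_sup_right
  · exact le_add_of_nonneg_of_le le_sup_right le_sup_left
  · exact add_nonneg le_sup_right le_sup_right

/-- The positive and negative parts of `x` are disjoint, so a prime ideal contains one of them: the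
quotient is totally ordered. -/
theorem total (hprime : ∀ x y : E, 0 ≤ x → 0 ≤ y → x ⊓ y = 0 → x ∈ P ∨ y ∈ P) (x : E) :
    NegMod P x ∨ NegMod P (-x) := by
  apply hprime _ _ le_sup_right le_sup_right
  have := posPart_inf_negPart_eq_zero x
  rwa [posPart_def, negPart_def] at this

theorem of_nonpos (hP : IsPosIdeal P) {x : E} (hx : x ≤ 0) : NegMod P x := by
  unfold NegMod
  rw [sup_eq_right.2 hx]
  exact hP.zero_mem

end NegMod

/-- `c` is the value of `x` relative to the unit `e`, modulo the ideal. -/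
def ValMod (P : Set E) (e x : E) (c : ℝ) : Prop :=
  ∀ ε : ℝ, 0 < ε → NegMod P (x - (c + ε) • e) ∧ NegMod P ((c - ε) • e - x)

namespace ValMod

variable {P : Set E} {e : E}

theorem le_of_le (hP : IsPosIdeal P) (he : 0 ≤ e) (heP : e ∉ P) {x y : E} {c d : ℝ}
    (hx : ValMod P e x c) (hy : ValMod P e y d) (hxy : x ≤ y) : c ≤ d := by
  by_contra! hlt
  -- With a third of the gap as tolerance, the two approximations still differ by a third, which
  -- would put a positive multiple of `e` into `P`.
  have hε : 0 < (c - d) / 3 := by linarith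
  have h1 := (hx _ hε).2
  have h2 := (hy _ hε).1
  have h3 := h1.add hP h2
  have h4 : NegMod P (((c - d) / 3) • e) := by
    refine NegMod.mono hP ?_ h3
    have : (c - (c - d) / 3) • e - x + (y - (d + (c - d) / 3) • e)
        = ((c - d) / 3) • e + (y - x) := by
      have : (c - d) / 3 = (c - (c - d) / 3) - (d + (c - d) / 3) := by ring
      conv_rhs => rw [this, sub_smul]
      abel
    rw [this]
    exact le_add_of_nonneg_right (sub_nonneg.2 hxy)
  have h5 := h4.smul hP (inv_nonneg.2 hε.le)
  rw [smul_smul, inv_mul_cancel₀ hε.ne', one_smul] at h5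
  unfold NegMod at h5
  rw [sup_eq_left.2 he] at h5
  exact heP h5

theorem unique (hP : IsPosIdeal P) (he : 0 ≤ e) (heP : e ∉ P) {x : E} {c d : ℝ}
    (hc : ValMod P e x c) (hd : ValMod P e x d) : c = d :=
  le_antisymm (hc.le_of_le hP he heP hd le_rfl) (hd.le_of_le hP he heP hc le_rfl)

theorem add (hP : IsPosIdeal P) {x y : E} {c d : ℝ} (hx : ValMod P e x c) (hy : ValMod P e y d) :
    ValMod P e (x + y) (c + d) := by
  intro ε hε
  have h1 := hx _ (half_pos hε)
  have h2 := hy _ (half_pos hε)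
  constructor
  · convert h1.1.add hP h2.1 using 1
    have : c + d + ε = (c + ε / 2) + (d + ε / 2) := by ring
    rw [this, add_smul]
    abel
  · convert h1.2.add hP h2.2 using 1
    have : c + d - ε = (c - ε / 2) + (d - ε / 2) := by ring
    rw [this, add_smul]
    abel

theorem neg {x : E} {c : ℝ} (hx : ValMod P e x c) : ValMod P e (-x) (-c) := by
  intro ε hε
  constructor
  · convert (hx ε hε).2 using 1
    have : -c + ε = -(c - ε) := by ring
    rw [this, neg_smul]; abel
  · convert (hx ε hε).1 using 1
    have : -c - ε = -(c + ε) := by ring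
    rw [this, neg_smul]; abel

theorem zero (hP : IsPosIdeal P) (he : 0 ≤ e) : ValMod P e 0 0 := by
  intro ε hε
  constructor <;> apply NegMod.of_nonpos hP
  · simpa using smul_nonneg hε.le he
  · simpa using smul_nonneg hε.le he

theorem smul (hP : IsPosIdeal P) (he : 0 ≤ e) (r : ℝ) {x : E} {c : ℝ} (hx : ValMod P e x c) :
    ValMod P e (r • x) (r * c) := by
  have key : ∀ t : ℝ, 0 < t → ValMod P e (t • x) (t * c) := by
    intro t ht ε hε
    have h := hx (ε / t) (div_pos hε ht)
    have h1 : t * c + ε = t * (c + ε / t) := by field_simp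
    have h2 : t * c - ε = t * (c - ε / t) := by field_simp
    rw [h1, h2, mul_smul, mul_smul, ← smul_sub, ← smul_sub]
    exact ⟨h.1.smul hP ht.le, h.2.smul hP ht.le⟩
  rcases lt_trichotomy r 0 with hr | rfl | hr
  · have := (key (-r) (neg_pos.2 hr)).neg
    rw [neg_smul, neg_neg] at this
    convert this using 1
    ring
  · rw [zero_smul, zero_mul]
    exact zero hP he
  · exact key r hr

theorem sup (hP : IsPosIdeal P) (he : 0 ≤ e) {x y : E} {c d : ℝ} (hx : ValMod P e x c)
    (hy : ValMod P e y d) : ValMod P e (x ⊔ y) (c ⊔ d) := by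
  intro ε hε
  constructor
  · rw [sup_sub]
    apply NegMod.sup hP
    · exact NegMod.mono hP (sub_le_sub_left
        (smul_le_smul_right_vl (by gcongr; exact le_sup_left) he) x) (hx ε hε).1
    · exact NegMod.mono hP (sub_le_sub_left
        (smul_le_smul_right_vl (by gcongr; exact le_sup_right) he) y) (hy ε hε).1
  · rcases le_total c d with h | h
    · rw [sup_eq_right.2 h]
      exact NegMod.mono hP (sub_le_sub_left le_sup_right _) (hy ε hε).2
    · rw [sup_eq_left.2 h]
      exact NegMod.mono hP (sub_le_sub_left le_sup_left _) (hx ε hε).2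

theorem inf (hP : IsPosIdeal P) (he : 0 ≤ e) {x y : E} {c d : ℝ} (hx : ValMod P e x c)
    (hy : ValMod P e y d) : ValMod P e (x ⊓ y) (c ⊓ d) := by
  have := (hx.neg.sup hP he hy.neg).neg
  rwa [← neg_inf, neg_neg, ← neg_inf, neg_neg] at this

theorem unit (hP : IsPosIdeal P) (he : 0 ≤ e) : ValMod P e e 1 := by
  intro ε hε
  constructor <;> apply NegMod.of_nonpos hP
  · have : e - (1 + ε) • e = -(ε • e) := by rw [add_smul, one_smul]; abel
    rw [this]
    exact neg_nonpos.2 (smul_nonneg hε.le he)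
  · have : (1 - ε) • e - e = -(ε • e) := by rw [sub_smul, one_smul]; abel
    rw [this]
    exact neg_nonpos.2 (smul_nonneg hε.le he)

/-- A Dedekind cut: the value is the supremum of the `r` with `r e ≤ x` modulo `P`. The bound makes
this set nonempty and bounded above, and totality of the quotient gives the upper estimate. -/
theorem exists_of_bounded (hP : IsPosIdeal P) (he : 0 ≤ e) (heP : e ∉ P)
    (hprime : ∀ x y : E, 0 ≤ x → 0 ≤ y → x ⊓ y = 0 → x ∈ P ∨ y ∈ P) {x : E} {K : ℝ}
    (h : NegMod P (|x| - K • e)) : ∃ c, ValMod P e x c := by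
  set S : Set ℝ := {r | NegMod P (r • e - x)} with hS
  have hlow : -K ∈ S := by
    refine NegMod.mono hP ?_ h
    rw [neg_smul, sub_eq_add_neg, add_comm, sub_eq_add_neg]
    gcongr
    exact neg_le_abs x
  have hup : NegMod P (x - K • e) := NegMod.mono hP (sub_le_sub_right (le_abs_self x) _) h
  have hpos : ∀ t : ℝ, 0 < t → ¬ NegMod P (t • e) := by
    intro t ht hn
    have h5 := hn.smul hP (inv_nonneg.2 ht.le)
    rw [smul_smul, inv_mul_cancel₀ ht.ne', one_smul] at h5
    unfold NegMod at h5
    rw [sup_eq_left.2 he] at h5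
    exact heP h5
  have hbdd : BddAbove S := by
    refine ⟨K, fun r hr => ?_⟩
    by_contra! hlt
    apply hpos (r - K) (sub_pos.2 hlt)
    convert NegMod.add hP hr hup using 1
    rw [sub_smul]; abel
  refine ⟨sSup S, fun ε hε => ⟨?_, ?_⟩⟩
  · have hnot : sSup S + ε ∉ S := fun hmem => by
      have := le_csSup hbdd hmem
      linarith
    have := (NegMod.total hprime ((sSup S + ε) • e - x)).resolve_left hnot
    rwa [neg_sub] at this
  · obtain ⟨r, hr, hlt⟩ := exists_lt_of_lt_csSup ⟨_, hlow⟩ (sub_lt_self (sSup S) hε)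
    exact NegMod.mono hP (sub_le_sub_right (smul_le_smul_right_vl hlt.le he) x) hr

end ValMod

/-- Countably many elements of an Archimedean vector lattice admit a real-valued homomorphism on
the vector sublattice they generate that does not vanish at a given positive one. -/
theorem exists_homOn_ne_zero {C : Set E} (hC : C.Countable) {e : E} (heC : e ∈ C) (he : 0 < e) :
    ∃ ω : E → ℝ, HomOn ω (VectorSublattice.generated C) ∧ ω e = 1 := by
  obtain ⟨c, rfl⟩ := hC.exists_eq_range ⟨e, heC⟩
  obtain ⟨u, hu0, hu, hupos, hstep⟩ := exists_antitone_dominating he c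
  obtain ⟨P, hP, hPu, hprime⟩ := exists_prime_posIdeal u hu hupos
  have heP : e ∉ P := hu0 ▸ hPu 0
  have hval : ∀ n, ∃ r, ValMod P e (c n) r := by
    intro n
    obtain ⟨k, hk, hun⟩ := hstep n
    -- Since `u (n + 1) ∉ P`, totality reverses the comparison and gives `k |c n| ≤ u n ≤ e` modulo
    -- `P`.
    have h1 : ¬ NegMod P (u n - k • |c n|) := by
      unfold NegMod
      rw [← hun]
      exact hPu (n + 1)
    have h2 := ((NegMod.total hprime _).resolve_left h1).smul hP (inv_nonneg.2 hk.le)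
    rw [neg_sub, smul_sub, smul_smul, inv_mul_cancel₀ hk.ne', one_smul] at h2
    refine ValMod.exists_of_bounded hP he.le heP hprime (K := k⁻¹) (NegMod.mono hP ?_ h2)
    refine sub_le_sub_left (smul_le_smul_of_nonneg_left ?_ (inv_nonneg.2 hk.le)) _
    exact (hu (Nat.zero_le n)).trans hu0.le
  let L : VectorSublattice E :=
    { carrier := {x | ∃ r, ValMod P e x r}
      add_mem' := fun ⟨r, hr⟩ ⟨t, ht⟩ => ⟨r + t, hr.add hP ht⟩
      zero_mem' := ⟨0, ValMod.zero hP he.le⟩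
      smul_mem' := fun r _ ⟨t, ht⟩ => ⟨r * t, ht.smul hP he.le r⟩
      sup_mem' := fun ⟨r, hr⟩ ⟨t, ht⟩ => ⟨r ⊔ t, hr.sup hP he.le ht⟩
      inf_mem' := fun ⟨r, hr⟩ ⟨t, ht⟩ => ⟨r ⊓ t, hr.inf hP he.le ht⟩ }
  have hLmem : ∀ x, x ∈ L ↔ ∃ r, ValMod P e x r := fun _ => Iff.rfl
  classical
  let ω : E → ℝ := fun x => if h : ∃ r, ValMod P e x r then h.choose else 0
  have hω : ∀ x r, ValMod P e x r → ω x = r := by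
    intro x r hr
    have h : ∃ r, ValMod P e x r := ⟨r, hr⟩
    have : ω x = h.choose := dif_pos h
    rw [this]
    exact h.choose_spec.unique hP he.le heP hr
  have hhom : HomOn ω L := by
    refine ⟨?_, ?_, ?_, ?_⟩
    · rintro x ⟨r, hr⟩ y ⟨t, ht⟩
      rw [hω _ _ hr, hω _ _ ht, hω _ _ (hr.add hP ht)]
    · rintro a x ⟨r, hr⟩
      rw [hω _ _ hr, hω _ _ (hr.smul hP he.le a), smul_eq_mul]
    · rintro x ⟨r, hr⟩ y ⟨t, ht⟩
      rw [hω _ _ hr, hω _ _ ht, hω _ _ (hr.sup hP he.le ht)]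
    · rintro x ⟨r, hr⟩ y ⟨t, ht⟩
      rw [hω _ _ hr, hω _ _ ht, hω _ _ (hr.inf hP he.le ht)]
  refine ⟨ω, hhom.mono fun x hx => VectorSublattice.generated_le ?_ hx,
    hω _ _ (ValMod.unit hP he.le)⟩
  rintro _ ⟨n, rfl⟩
  exact hval n

end Points

/-! ### Germs of real functions along a filter -/

section Germ

variable {X : Type*} {l : Filter X}

instance : PosSMulMono ℝ (Germ l ℝ) where
  smul_le_smul_of_nonneg_left := by
    intro r hr a b
    induction a, b using Germ.inductionOn₂ with
    | _ f g =>
      intro h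
      exact (Germ.coe_le.1 h).mono fun x hx => mul_le_mul_of_nonneg_left hx hr

/-- Countable intersections let all the inequalities `n f ≤ g` hold at the same point, where the
Archimedean property of `ℝ` applies. -/
instance [CountableInterFilter l] : ArchimedeanVectorLattice (Germ l ℝ) where
  eq_zero_of_nsmul_le := by
    intro a b
    induction a, b using Germ.inductionOn₂ with
    | _ f g =>
      intro h0 h
      have h1 : ∀ᶠ x in l, ∀ n : ℕ, n • f x ≤ g x :=
        eventually_countable_forall.2 fun n => Germ.coe_le.1 (h n)
      apply Germ.coe_eq.2
      filter_upwards [Germ.coe_nonneg.1 h0, h1] with x hx0 hx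
      by_contra hne
      obtain ⟨n, hn⟩ := exists_nat_gt (g x / f x)
      have hpos : 0 < f x := lt_of_le_of_ne hx0 (Ne.symm hne)
      have h2 := hx n
      rw [nsmul_eq_mul] at h2
      rw [div_lt_iff₀ hpos] at hn
      linarith

end Germ

/-! ### Relatively uniform convergence with a given regulator -/

section Regulator

variable {E : Type*} [AddCommGroup E] [Lattice E] [Module ℝ E] [ArchimedeanVectorLattice E]

/-- Relatively uniform convergence with regulator `p`. -/
def ConvWith (p : E) (f : ℕ → E) (g : E) : Prop :=
  ∀ ε : ℝ, 0 < ε → ∃ N : ℕ, ∀ n, N ≤ n → |f n - g| ≤ ε • p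

/-- The relatively uniform Cauchy property with regulator `p`. -/
def CauchyWith (p : E) (f : ℕ → E) : Prop :=
  ∀ ε : ℝ, 0 < ε → ∃ N : ℕ, ∀ m n, N ≤ m → N ≤ n → |f m - f n| ≤ ε • p

theorem half_smul_lt {p : E} (hp : 0 < p) {ε : ℝ} (hε : 0 < ε) : (ε / 2) • p < ε • p := by
  apply lt_of_le_of_ne (smul_le_smul_right_vl (by linarith) hp.le)
  intro h
  have h1 : (ε / 2) • p = 0 := by
    have h2 : ε • p - (ε / 2) • p = (ε / 2) • p := by
      rw [← sub_smul]; congr 1; ring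
    rw [← h2, h, sub_self]
  exact (smul_ne_zero (half_pos hε).ne' hp.ne') h1

theorem RUConverges.exists_convWith {f : ℕ → E} {g : E} (h : RUConverges f g) :
    ∃ p, 0 < p ∧ ConvWith p f g := by
  obtain ⟨p, hp, h⟩ := h
  refine ⟨p, hp, fun ε hε => ?_⟩
  obtain ⟨N, hN⟩ := h ε hε
  exact ⟨N, fun n hn => (hN n hn).le⟩

theorem ConvWith.ruConverges {p : E} (hp : 0 < p) {f : ℕ → E} {g : E} (h : ConvWith p f g) :
    RUConverges f g := by
  refine ⟨p, hp, fun ε hε => ?_⟩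
  obtain ⟨N, hN⟩ := h (ε / 2) (half_pos hε)
  exact ⟨N, fun n hn => (hN n hn).trans_lt (half_smul_lt hp hε)⟩

theorem RUCauchy.exists_cauchyWith {f : ℕ → E} (h : RUCauchy f) : ∃ p, 0 < p ∧ CauchyWith p f := by
  obtain ⟨p, hp, h⟩ := h
  refine ⟨p, hp, fun ε hε => ?_⟩
  obtain ⟨N, hN⟩ := h ε hε
  exact ⟨N, fun m n hm hn => (hN m n hm hn).le⟩

theorem CauchyWith.ruCauchy {p : E} (hp : 0 < p) {f : ℕ → E} (h : CauchyWith p f) : RUCauchy f := by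
  refine ⟨p, hp, fun ε hε => ?_⟩
  obtain ⟨N, hN⟩ := h (ε / 2) (half_pos hε)
  exact ⟨N, fun m n hm hn => (hN m n hm hn).trans_lt (half_smul_lt hp hε)⟩

theorem ConvWith.cauchyWith {p : E} {f : ℕ → E} {g : E} (h : ConvWith p f g) : CauchyWith p f := by
  intro ε hε
  obtain ⟨N, hN⟩ := h (ε / 2) (half_pos hε)
  refine ⟨N, fun m n hm hn => ?_⟩
  calc |f m - f n| ≤ |f m - g| + |g - f n| := abs_sub_le_vl _ _ _
    _ ≤ (ε / 2) • p + (ε / 2) • p := by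
        rw [abs_sub_comm g]
        exact add_le_add (hN m hm) (hN n hn)
    _ = ε • p := by rw [← add_smul, add_halves]

theorem ConvWith.unique {p q : E} {f : ℕ → E} {g g' : E} (h : ConvWith p f g)
    (h' : ConvWith q f g') : g = g' := by
  rw [← sub_eq_zero, ← abs_eq_zero_vl]
  apply eq_zero_of_le_smul (p := p + q) (abs_nonneg _)
  intro ε hε
  obtain ⟨N, hN⟩ := h ε hε
  obtain ⟨M, hM⟩ := h' ε hε
  calc |g - g'| ≤ |g - f (max N M)| + |f (max N M) - g'| := abs_sub_le_vl _ _ _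
    _ ≤ ε • p + ε • q := by
        rw [abs_sub_comm g]
        exact add_le_add (hN _ (le_max_left _ _)) (hM _ (le_max_right _ _))
    _ = _ := (smul_add _ _ _).symm

omit [ArchimedeanVectorLattice E] in
theorem ConvWith.map {R : Type*} [AddCommGroup R] [Lattice R] [Module ℝ R]
    (T : VLHom E R) {p : E} {f : ℕ → E} {g : E} (h : ConvWith p f g) :
    ConvWith (T p) (fun n => T (f n)) (T g) := by
  intro ε hε
  obtain ⟨N, hN⟩ := h ε hε
  refine ⟨N, fun n hn => ?_⟩
  rw [← T.map_sub, ← T.map_abs, ← T.map_smul]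
  exact T.map_le (hN n hn)

theorem IsUniformlyComplete.exists_convWith (hE : IsUniformlyComplete E) {p : E} (hp : 0 ≤ p)
    {f : ℕ → E} (h : CauchyWith p f) : ∃ q g, ConvWith q f g := by
  -- Uniform completeness requires a strictly positive regulator. With regulator zero the sequence
  -- is eventually constant.
  rcases hp.eq_or_lt with rfl | hp
  · obtain ⟨N, hN⟩ := h 1 one_pos
    refine ⟨0, f N, fun ε _ => ⟨N, fun n hn => ?_⟩⟩
    simpa using hN n N hn le_rfl
  · obtain ⟨g, hg⟩ := hE f (h.ruCauchy hp)
    obtain ⟨q, -, hq⟩ := hg.exists_convWith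
    exact ⟨q, g, hq⟩

/-- A vector sublattice that contains the limits of its sequences that converge relatively
uniformly with a regulator in it. -/
def VectorSublattice.RUClosed (L : VectorSublattice E) : Prop :=
  ∀ (p : E) (f : ℕ → E) (g : E), 0 < p → p ∈ L → (∀ n, f n ∈ L) → ConvWith p f g → g ∈ L

/-- The smallest relatively uniformly closed vector sublattice containing a set. -/
def VectorSublattice.ruClosure (A : Set E) : VectorSublattice E where
  carrier := {x | ∀ L : VectorSublattice E, L.RUClosed → A ⊆ L → x ∈ L}
  add_mem' hx hy L hL hA := add_mem (hx L hL hA) (hy L hL hA)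
  zero_mem' L _ _ := zero_mem L
  smul_mem' r _ hx L hL hA := SMulMemClass.smul_mem r (hx L hL hA)
  sup_mem' hx hy L hL hA := L.sup_mem' (hx L hL hA) (hy L hL hA)
  inf_mem' hx hy L hL hA := L.inf_mem' (hx L hL hA) (hy L hL hA)

theorem VectorSublattice.subset_ruClosure (A : Set E) : A ⊆ ruClosure A :=
  fun _ hx _ _ hA => hA hx

theorem VectorSublattice.ruClosed_ruClosure (A : Set E) : (ruClosure A).RUClosed :=
  fun p f g hp hpL hf h L hL hA => hL p f g hp (hpL L hL hA) (fun n => hf n L hL hA) h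

theorem VectorSublattice.RUClosed.isUniformlyComplete {L : VectorSublattice E}
    (hE : IsUniformlyComplete E) (hL : L.RUClosed) : IsUniformlyComplete L := by
  intro f hf
  obtain ⟨p, hp, hf⟩ := hf.exists_cauchyWith
  have hp' : 0 < (p : E) := hp
  have hf' : CauchyWith (p : E) fun n => (f n : E) := fun ε hε => hf ε hε
  obtain ⟨q, g, hg⟩ := hE.exists_convWith hp'.le hf'
  -- The regulator `q` supplied by completeness may lie outside `L`. Passing to the limit in the
  -- Cauchy estimates, with `q` contributing arbitrarily little, shows that the regulator `p ∈ L`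
  -- works as well.
  have hconv : ConvWith (p : E) (fun n => (f n : E)) g := by
    intro ε hε
    obtain ⟨N, hN⟩ := hf' ε hε
    refine ⟨N, fun n hn => le_of_forall_le_add_smul (p := q) fun δ hδ => ?_⟩
    obtain ⟨M, hM⟩ := hg δ hδ
    calc |(f n : E) - g| ≤ |(f n : E) - f (max N M)| + |(f (max N M) : E) - g| := abs_sub_le_vl _ _ _
      _ ≤ _ := add_le_add (hN _ _ hn (le_max_left _ _)) (hM _ (le_max_right _ _))
  have hgL : g ∈ L := hL p _ g hp' p.2 (fun n => (f n).2) hconv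
  exact ⟨⟨g, hgL⟩, ConvWith.ruConverges hp fun ε hε => hconv ε hε⟩

theorem VectorSublattice.RUClosed.preimage {R : Type*} [AddCommGroup R] [Lattice R] [Module ℝ R]
    [ArchimedeanVectorLattice R] {M : VectorSublattice R} (hM : M.RUClosed) (T : VLHom E R)
    (L : VectorSublattice E) (hL : L.RUClosed) : ((T.homOn L).preimage M).RUClosed := by
  intro p f g hp hpL hf h
  refine ⟨hL p f g hp hpL.1 (fun n => (hf n).1) h, ?_⟩
  -- If `T p = 0`, then `T g` equals some `T (f N)` and closedness of `M` is not needed.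
  rcases (T.map_nonneg hp.le).eq_or_lt with h0 | h0
  · obtain ⟨N, hN⟩ := h.map T 1 one_pos
    have := hN N le_rfl
    rw [← h0, smul_zero] at this
    have h1 := abs_eq_zero_vl.1 (le_antisymm this (abs_nonneg _))
    rw [sub_eq_zero] at h1
    rw [← h1]
    exact (hf N).2
  · exact hM (T p) (fun n => T (f n)) (T g) h0 hpL.2 (fun n => (hf n).2) (h.map T)

/-- An injective homomorphism reflects the order, so a convergent sequence in the range, with
regulator in the range, pulls back to a Cauchy sequence in `E`. The image of its limit is the given
limit by uniqueness. -/
theorem VectorSublattice.ruClosed_range {R : Type*} [AddCommGroup R] [Lattice R] [Module ℝ R]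
    [ArchimedeanVectorLattice R] (hE : IsUniformlyComplete E) (J : VLHom E R)
    (hJ : Function.Injective J) : J.range.RUClosed := by
  rintro _ f g hp ⟨p, rfl⟩ hf h
  choose e he using hf
  have hp0 : 0 ≤ p := VLHom.le_of_map_le hJ (by rw [J.map_zero]; exact hp.le)
  have hc : CauchyWith p e := by
    intro ε hε
    obtain ⟨N, hN⟩ := h.cauchyWith ε hε
    refine ⟨N, fun m n hm hn => VLHom.le_of_map_le hJ ?_⟩
    rw [J.map_abs, J.map_sub, J.map_smul]
    have := hN m n hm hn
    rw [← he, ← he] at this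
    exact this
  obtain ⟨q, x, hx⟩ := hE.exists_convWith hp0 hc
  have h1 := hx.map J
  have h2 : (fun n => J (e n)) = f := funext he
  rw [h2] at h1
  exact ⟨x, (h.unique h1).symm⟩

theorem HomOn.ruClosed_eqLocus {R : Type*} [AddCommGroup R] [Lattice R] [Module ℝ R]
    [ArchimedeanVectorLattice R] (S T : VLHom E R) (L : VectorSublattice E) (hL : L.RUClosed) :
    ((S.homOn L).eqLocus (T.homOn L)).RUClosed := by
  intro p f g hp hpL hf h
  refine ⟨hL p f g hp hpL.1 (fun n => (hf n).1) h, (h.map S).unique (q := T p) ?_⟩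
  have : (fun n => S (f n)) = fun n => T (f n) := funext fun n => (hf n).2
  rw [this]
  exact h.map T

end Regulator

/-- Tolerances `1/(k+1)` suffice, so only countably many inequalities between representatives are
involved. They hold simultaneously at almost every point, and there the pointwise limit obeys the
same estimates. -/
theorem isUniformlyComplete_germ {X : Type*} (l : Filter X) [CountableInterFilter l] :
    IsUniformlyComplete (Germ l ℝ) := by
  intro f hf
  obtain ⟨p, hp, hf⟩ := hf.exists_cauchyWith
  have hrep : ∀ a : Germ l ℝ, ∃ F : X → ℝ, (F : Germ l ℝ) = a := fun a =>
    Germ.inductionOn a fun F => ⟨F, rfl⟩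
  choose F hF using fun n => hrep (f n)
  obtain ⟨P, rfl⟩ := hrep p
  obtain rfl : (fun n => (F n : Germ l ℝ)) = f := funext hF
  have hc : ∀ k : ℕ, ∃ N, ∀ m n, N ≤ m → N ≤ n →
      ∀ᶠ x in l, |F m x - F n x| ≤ (1 / (k + 1 : ℝ)) * P x := by
    intro k
    obtain ⟨N, hN⟩ := hf (1 / (k + 1 : ℝ)) (by positivity)
    exact ⟨N, fun m n hm hn => Germ.coe_le.1 (hN m n hm hn)⟩
  choose N hN using hc
  have hall : ∀ᶠ x in l, ∀ k m n, N k ≤ m → N k ≤ n →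
      |F m x - F n x| ≤ (1 / (k + 1 : ℝ)) * P x := by
    refine eventually_countable_forall.2 fun k => eventually_countable_forall.2 fun m =>
      eventually_countable_forall.2 fun n => ?_
    by_cases h : N k ≤ m ∧ N k ≤ n
    · filter_upwards [hN k m n h.1 h.2] with x hx _ _ using hx
    · exact Eventually.of_forall fun x h1 h2 => (h ⟨h1, h2⟩).elim
  let g : X → ℝ := fun x => limUnder atTop fun n => F n x
  refine ⟨(g : Germ l ℝ), ConvWith.ruConverges hp fun ε hε => ?_⟩
  obtain ⟨k, hk⟩ := exists_nat_one_div_lt hε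
  refine ⟨N k, fun n hn => Germ.coe_le.2 ?_⟩
  filter_upwards [hall, Germ.coe_nonneg.1 hp.le] with x hx hPx
  have hcau : CauchySeq fun n => F n x := by
    rw [Metric.cauchySeq_iff]
    intro δ hδ
    -- The regulator may vanish at `x`, hence the denominator `P x + 1`.
    obtain ⟨j, hj⟩ := exists_nat_one_div_lt (div_pos hδ (by linarith : 0 < P x + 1))
    refine ⟨N j, fun m hm n hn => ?_⟩
    rw [Real.dist_eq]
    refine (hx j m n hm hn).trans_lt ?_
    rw [lt_div_iff₀ (by linarith)] at hj
    have : (0 : ℝ) < 1 / (j + 1) := by positivity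
    nlinarith
  have hlim : Tendsto (fun n => F n x) atTop (nhds (g x)) := hcau.tendsto_limUnder
  have h1 : |F n x - g x| ≤ (1 / (k + 1 : ℝ)) * P x := by
    have h2 : Tendsto (fun m => |F n x - F m x|) atTop (nhds |F n x - g x|) :=
      (tendsto_const_nhds.sub hlim).abs
    exact le_of_tendsto h2 ((eventually_ge_atTop (N k)).mono fun m hm => hx k n m hn hm)
  exact h1.trans (mul_le_mul_of_nonneg_right hk.le hPx)

/-! ### The canonical embedding into germs -/

section Eval

variable (E : Type*) [AddCommGroup E] [Lattice E] [Module ℝ E]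

/-- The sets of real functions on `E` containing all those that are vector lattice homomorphisms
on the sublattice generated by some countable set. -/
def evalFilter : Filter (E → ℝ) where
  sets := {A | ∃ C : Set E, C.Countable ∧
    ∀ ω : E → ℝ, HomOn ω (VectorSublattice.generated C) → ω ∈ A}
  univ_sets := ⟨∅, Set.countable_empty, fun _ _ => trivial⟩
  sets_of_superset := fun ⟨C, hC, h⟩ hAB => ⟨C, hC, fun ω hω => hAB (h ω hω)⟩
  inter_sets := by
    rintro A B ⟨C, hC, h⟩ ⟨C', hC', h'⟩
    exact ⟨C ∪ C', hC.union hC', fun ω hω =>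
      ⟨h ω (hω.mono fun x hx => VectorSublattice.generated_mono Set.subset_union_left hx),
        h' ω (hω.mono fun x hx => VectorSublattice.generated_mono Set.subset_union_right hx)⟩⟩

variable {E}

theorem mem_evalFilter {A : Set (E → ℝ)} : A ∈ evalFilter E ↔ ∃ C : Set E, C.Countable ∧
    ∀ ω : E → ℝ, HomOn ω (VectorSublattice.generated C) → ω ∈ A := Iff.rfl

theorem eventually_homOn {C : Set E} (hC : C.Countable) :
    ∀ᶠ ω in evalFilter E, HomOn ω (VectorSublattice.generated C) :=
  ⟨C, hC, fun _ h => h⟩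

instance : CountableInterFilter (evalFilter E) where
  countable_sInter_mem := by
    intro S hS h
    choose! C hC hmem using fun s hs => mem_evalFilter.1 (h s hs)
    refine ⟨⋃ s ∈ S, C s, hS.biUnion hC, fun ω hω s hs => hmem s hs ω ?_⟩
    exact hω.mono fun x hx =>
      VectorSublattice.generated_mono (Set.subset_biUnion_of_mem (u := C) hs) hx

variable (E) in
/-- The canonical homomorphism from `E` into germs of functions on `E → ℝ`. -/
def evalGerm : VLHom E (Germ (evalFilter E) ℝ) where
  toLin :=
    { toFun := fun x => ((fun ω => ω x : (E → ℝ) → ℝ) : Germ (evalFilter E) ℝ)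
      map_add' := fun x y => Germ.coe_eq.2 <| by
        filter_upwards [eventually_homOn (C := {x, y}) (Set.toFinite _).countable] with ω hω
        exact hω.map_add x (VectorSublattice.subset_generated _ (by simp)) y
          (VectorSublattice.subset_generated _ (by simp))
      map_smul' := fun r x => Germ.coe_eq.2 <| by
        filter_upwards [eventually_homOn (C := {x}) (Set.toFinite _).countable] with ω hω
        exact hω.map_smul r x (VectorSublattice.subset_generated _ (by simp)) }
  isLatticeHom x y := by
    constructor
    · refine Germ.coe_eq.2 ?_
      filter_upwards [eventually_homOn (C := {x, y}) (Set.toFinite _).countable] with ω hω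
      exact hω.map_sup x (VectorSublattice.subset_generated _ (by simp)) y
          (VectorSublattice.subset_generated _ (by simp))
    · refine Germ.coe_eq.2 ?_
      filter_upwards [eventually_homOn (C := {x, y}) (Set.toFinite _).countable] with ω hω
      exact hω.map_inf x (VectorSublattice.subset_generated _ (by simp)) y
          (VectorSublattice.subset_generated _ (by simp))

/-- A vanishing germ means that all homomorphisms on some countably generated sublattice kill `x`.
Adding `x` and `|x|` to the generators keeps them countable, and some homomorphism there takes `|x|`
to `1`. -/
theorem evalGerm_injective [ArchimedeanVectorLattice E] : Function.Injective (evalGerm E) := by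
  apply VLHom.injective_of_eq_zero
  intro x hx
  by_contra hne
  obtain ⟨C, hC, h⟩ := mem_evalFilter.1 (Germ.coe_eq.1 hx)
  have hpos : 0 < |x| := 
    lt_of_le_of_ne (abs_nonneg x) fun h => hne (abs_eq_zero_vl.1 h.symm)
  obtain ⟨ω, hω, h1⟩ := exists_homOn_ne_zero (C := insert |x| (insert x C))
    ((hC.insert _).insert _) (by simp) hpos
  have h0 : ω x = 0 := h ω (hω.mono fun y hy => VectorSublattice.generated_mono
    ((Set.subset_insert _ _).trans (Set.subset_insert _ _)) hy)
  rw [hω.map_abs (VectorSublattice.subset_generated _ (by simp)), h0, abs_zero] at h1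
  exact zero_ne_one h1

variable {H : Type*} [AddCommGroup H] [Lattice H] [Module ℝ H]

theorem tendsto_comp_evalFilter (T : VLHom E H) :
    Tendsto (fun ω : H → ℝ => ω ∘ T) (evalFilter H) (evalFilter E) := by
  rintro A ⟨C, hC, h⟩
  refine ⟨T '' C, hC.image T, fun ω hω => h _ ?_⟩
  exact hω.comp (T.homOn _) fun x hx => (T.homOn _).mapsTo_generated
    (VectorSublattice.subset_generated C)
    (fun y hy => VectorSublattice.subset_generated _ (Set.mem_image_of_mem T hy)) hx

/-- The homomorphism of germs induced by a homomorphism. -/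
def germMap (T : VLHom E H) : VLHom (Germ (evalFilter E) ℝ) (Germ (evalFilter H) ℝ) where
  toLin :=
    { toFun := fun g => g.compTendsto _ (tendsto_comp_evalFilter T)
      map_add' := fun a b => Germ.inductionOn₂ a b fun _ _ => rfl
      map_smul' := fun _ a => Germ.inductionOn a fun _ => rfl }
  isLatticeHom a b := Germ.inductionOn₂ a b fun _ _ => ⟨rfl, rfl⟩

theorem germMap_evalGerm (T : VLHom E H) (x : E) :
    germMap T (evalGerm E x) = evalGerm H (T x) := rfl

end Eval

/-! ### Existence of uniform completions -/

/-- The completion is the relatively uniform closure of `E` in its germs. A homomorphism `T` into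
`H` acts on all germs by functoriality. The image of a uniformly complete `H` is closed in its own
germs, so its preimage contains the closure of `E`, and the extension lands in `H`. Uniqueness holds
because two homomorphisms agree on a closed set. -/
theorem exists_isUniformCompletion (E : Type u) [AddCommGroup E] [Lattice E] [Module ℝ E]
    [ArchimedeanVectorLattice E] :
    ∃ (G : Type u) (_ : AddCommGroup G) (_ : Lattice G) (_ : Module ℝ G) (φ : VLHom E G),
      IsUniformCompletion φ := by
  let L : VectorSublattice (Germ (evalFilter E) ℝ) :=
    VectorSublattice.ruClosure (Set.range (evalGerm E))
  have hLc : L.RUClosed := VectorSublattice.ruClosed_ruClosure _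
  have hmem : ∀ x, evalGerm E x ∈ L := fun x => VectorSublattice.subset_ruClosure _ ⟨x, rfl⟩
  obtain ⟨φ, hφ⟩ := VLHom.exists_factor (evalGerm E) L.incl L.incl_injective
    fun x => ⟨⟨_, hmem x⟩, rfl⟩
  refine ⟨L, inferInstance, inferInstance, inferInstance, φ, inferInstance,
    hLc.isUniformlyComplete (isUniformlyComplete_germ _), ?_, ?_⟩
  · intro x y hxy
    apply evalGerm_injective
    rw [← hφ, ← hφ, hxy]
  · intro H _ _ _ _ hH T
    have hrange := VectorSublattice.ruClosed_range hH (evalGerm H) evalGerm_injective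
    obtain ⟨S, hS⟩ := VLHom.exists_factor ((germMap T).comp L.incl) (evalGerm H)
      evalGerm_injective fun x =>
        (x.2 _ (hrange.preimage (germMap T) L hLc) (by
          rintro _ ⟨y, rfl⟩
          exact ⟨hmem y, T y, (germMap_evalGerm T y).symm⟩)).2
    refine ⟨S, fun x => evalGerm_injective ?_, fun S' hS' => VLHom.ext fun x => ?_⟩
    · rw [hS, VLHom.comp_apply, hφ, germMap_evalGerm]
    · have huniv : (VectorSublattice.generated (Set.univ : Set L)).RUClosed :=
        fun _ _ _ _ _ _ _ => VectorSublattice.subset_generated _ trivial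
      have hagree : ∀ x, S (φ x) = T x := fun x => evalGerm_injective (by
        rw [hS, VLHom.comp_apply, hφ, germMap_evalGerm])
      let M := (S'.homOn (VectorSublattice.generated (Set.univ : Set L))).eqLocus (S.homOn _)
      have hM : M.RUClosed := HomOn.ruClosed_eqLocus S' S _ huniv
      -- `L` is the smallest closed sublattice of the germs containing `E`, so the agreement set,
      -- closed inside `L`, has to be seen as closed inside the germs.
      have hMe : (L.incl.homOn M).toVLHom.range.RUClosed := by
        rintro p f g hp ⟨p', rfl⟩ hf hconv
        choose f' hf' using hf
        have hf'L : ∀ n, f n ∈ L := fun n => hf' n ▸ (f' n).1.2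
        have hg : g ∈ L := hLc p'.1.1 f g hp p'.1.2 hf'L hconv
        refine ⟨⟨⟨g, hg⟩, hM p'.1 (fun n => (f' n).1) ⟨g, hg⟩ hp p'.2 (fun n => (f' n).2) ?_⟩, rfl⟩
        intro ε hε
        obtain ⟨N, hN⟩ := hconv ε hε
        refine ⟨N, fun n hn => ?_⟩
        have := hN n hn
        rw [← hf' n] at this
        exact this
      obtain ⟨y, hy⟩ := x.2 _ hMe (by
        rintro _ ⟨z, rfl⟩
        exact ⟨⟨φ z, VectorSublattice.subset_generated _ trivial,
          (hS' z).trans (hagree z).symm⟩, hφ z⟩)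
      have : y.1 = x := L.incl_injective hy
      rw [← this]
      exact y.2.2

/-! ### Functional calculus in germs -/

namespace PosHomFun

variable {m : ℕ} (h : PosHomFun m)

/-- Continuity of `h` at `t`, made homogeneous through `p = ∑ |y j|`. After scaling `y` into the
unit ball, either `y/p` is `δ`-close to `t` and the error is below `ε`, or the sum of deviations is
at least `δ` and `M = (K + |h t|)/δ` absorbs the crude bound `K + |h t|`. Apart from the value `h y`
itself, the inequality uses only vector lattice operations on `y`, so homomorphisms can be applied
to it. -/
theorem exists_bound_sub (t : Fin m → ℝ) {ε : ℝ} (hε : 0 < ε) :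
    ∃ M : ℝ, 0 ≤ M ∧ ∀ y : Fin m → ℝ, |h.toFun y - h.toFun t * (∑ j, |y j|)| ≤
      ε * (∑ j, |y j|) + M * ∑ i, |y i - t i * (∑ j, |y j|)| := by
  obtain ⟨δ, hδ, hcont⟩ := Metric.continuousAt_iff.1 (h.continuous_toFun.continuousAt (x := t)) ε hε
  obtain ⟨K, hK⟩ := (isCompact_closedBall (0 : Fin m → ℝ) 1).exists_bound_of_continuousOn
    h.continuous_toFun.continuousOn
  have hK0 : 0 ≤ K := (norm_nonneg _).trans (hK 0 (by simp))
  refine ⟨(K + |h.toFun t|) / δ, by positivity, fun y => ?_⟩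
  set p := ∑ j, |y j| with hp
  have hp0 : 0 ≤ p := Finset.sum_nonneg fun i _ => abs_nonneg _
  have hyp : ∀ i, |y i| ≤ p := fun i =>
    Finset.single_le_sum (f := fun j => |y j|) (fun j _ => abs_nonneg _) (Finset.mem_univ i)
  rcases hp0.eq_or_lt with h0 | hpos
  · have hy : y = 0 := funext fun i => abs_eq_zero.1
      (le_antisymm ((hyp i).trans h0.symm.le) (abs_nonneg _))
    rw [hy, h.map_zero, ← h0]
    simp
  set w : Fin m → ℝ := p⁻¹ • y with hw
  have hyw : y = p • w := by rw [hw, smul_smul, mul_inv_cancel₀ hpos.ne', one_smul]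
  have hyi : ∀ i, y i = p * w i := fun i => congrFun hyw i
  have hw1 : ‖w‖ ≤ 1 := by
    rw [pi_norm_le_iff_of_nonneg zero_le_one]
    intro i
    have := hyp i
    rw [hyi, abs_mul, abs_of_pos hpos] at this
    rw [Real.norm_eq_abs]
    by_contra! hlt
    nlinarith
  have hcore : |h.toFun w - h.toFun t| ≤ ε + (K + |h.toFun t|) / δ * ∑ i, |w i - t i| := by
    have hsum : 0 ≤ ∑ i, |w i - t i| := Finset.sum_nonneg fun i _ => abs_nonneg _
    by_cases hd : dist w t < δ
    · have := hcont hd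
      rw [Real.dist_eq] at this
      have h2 : 0 ≤ (K + |h.toFun t|) / δ * ∑ i, |w i - t i| := by positivity
      linarith
    · have h1 : δ ≤ ∑ i, |w i - t i| := by
        by_contra! hlt
        apply hd
        rw [dist_pi_lt_iff hδ]
        intro i
        rw [Real.dist_eq]
        exact (Finset.single_le_sum (f := fun i => |w i - t i|) (fun j _ => abs_nonneg _)
          (Finset.mem_univ i)).trans_lt hlt
      have h2 : |h.toFun w| ≤ K := hK w (by simpa using hw1)
      have h3 : |h.toFun w - h.toFun t| ≤ K + |h.toFun t| :=
        (abs_sub _ _).trans (by linarith)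
      have h4 : K + |h.toFun t| ≤ (K + |h.toFun t|) / δ * ∑ i, |w i - t i| := by
        rw [div_mul_eq_mul_div, le_div_iff₀ hδ]
        exact mul_le_mul_of_nonneg_left h1 (by positivity)
      linarith
  have e1 : h.toFun y - h.toFun t * p = p * (h.toFun w - h.toFun t) := by
    conv_lhs => rw [hyw, h.map_smul p w hp0]
    ring
  have e2 : ∑ i, |y i - t i * p| = p * ∑ i, |w i - t i| := by
    rw [Finset.mul_sum]
    refine Finset.sum_congr rfl fun i _ => ?_
    rw [hyi, ← abs_of_pos hpos, ← abs_mul, abs_of_pos hpos]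
    congr 1; ring
  rw [e1, e2, abs_mul, abs_of_pos hpos]
  calc p * |h.toFun w - h.toFun t| ≤ p * (ε + (K + |h.toFun t|) / δ * ∑ i, |w i - t i|) :=
        mul_le_mul_of_nonneg_left hcore hp0
    _ = _ := by ring

/-- The value of `h` at a tuple of germs. -/
noncomputable def germ {X : Type*} {l : Filter X} (α : Fin m → Germ l ℝ) : Germ l ℝ :=
  ((fun x => h.toFun fun i => Quotient.out (α i) x : X → ℝ) : Germ l ℝ)

end PosHomFun

section GermCalculus

variable {X : Type*} {l : Filter X}

theorem Filter.Germ.coe_quotient_out (α : Germ l ℝ) : ((Quotient.out α : X → ℝ) : Germ l ℝ) = α :=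
  Quotient.out_eq α

theorem Filter.Germ.coe_finset_sum {ι : Type*} (s : Finset ι) (f : ι → X → ℝ) :
    ∑ i ∈ s, ((f i : X → ℝ) : Germ l ℝ) = ((fun x => ∑ i ∈ s, f i x : X → ℝ) : Germ l ℝ) := by
  classical
  induction s using Finset.induction_on with
  | empty => rfl
  | insert a s ha ih =>
    rw [Finset.sum_insert ha, ih]
    simp only [Finset.sum_insert ha]
    rfl

theorem PosHomFun.germ_bound_sub {m : ℕ} (h : PosHomFun m) (t : Fin m → ℝ) {ε : ℝ} (hε : 0 < ε) :
    ∃ M : ℝ, 0 ≤ M ∧ ∀ α : Fin m → Germ l ℝ, |h.germ α - h.toFun t • (∑ j, |α j|)| ≤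
      ε • (∑ j, |α j|) + M • ∑ i, |α i - t i • (∑ j, |α j|)| := by
  obtain ⟨M, hM, hb⟩ := h.exists_bound_sub t hε
  refine ⟨M, hM, fun α => ?_⟩
  set F : Fin m → X → ℝ := fun i => Quotient.out (α i) with hF
  have hα : ∀ i, α i = ((F i : X → ℝ) : Germ l ℝ) := fun i => (Germ.coe_quotient_out (α i)).symm
  have h1 : ∑ j, |α j| = ((fun x => ∑ j, |F j x| : X → ℝ) : Germ l ℝ) := by
    rw [← Germ.coe_finset_sum]
    refine Finset.sum_congr rfl fun i _ => ?_
    rw [hα i]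
    rfl
  have h2 : ∑ i, |α i - t i • ((fun x => ∑ j, |F j x| : X → ℝ) : Germ l ℝ)| =
      ((fun x => ∑ i, |F i x - t i * (∑ j, |F j x|)| : X → ℝ) : Germ l ℝ) := by
    refine Eq.trans (Finset.sum_congr rfl fun i _ => ?_)
      (Germ.coe_finset_sum _ fun i x => |F i x - t i * (∑ j, |F j x|)|)
    rw [hα i]
    rfl
  rw [h1, h2]
  exact Germ.coe_le.2 (Eventually.of_forall fun x => hb fun i => F i x)

theorem PosHomFun.germ_bound {m : ℕ} (h : PosHomFun m) :
    ∃ K : ℝ, 0 ≤ K ∧ ∀ α : Fin m → Germ l ℝ, |h.germ α| ≤ K • ∑ j, |α j| := by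
  -- At `t = 0` the deviations are the `|α j|` themselves.
  obtain ⟨M, hM, h1⟩ := h.germ_bound_sub (l := l) 0 one_pos
  refine ⟨1 + M, by positivity, fun α => ?_⟩
  have := h1 α
  simp only [h.map_zero, zero_smul, sub_zero, Pi.zero_apply] at this
  rw [add_smul]
  exact this

/-- Real-valued homomorphisms on spaces of germs commute with positively homogeneous functions. -/
theorem HomOn.apply_germ {m : ℕ} (h : PosHomFun m) {ω : Germ l ℝ → ℝ}
    {L : VectorSublattice (Germ l ℝ)} (hω : HomOn ω L) {α : Fin m → Germ l ℝ}
    (hα : ∀ i, α i ∈ L) (hL : h.germ α ∈ L) : ω (h.germ α) = h.toFun fun i => ω (α i) := by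
  have hpL : ∑ j, |α j| ∈ L := sum_mem fun i _ => L.abs_mem (hα i)
  have hωp : ω (∑ j, |α j|) = ∑ j, |ω (α j)| := by
    rw [hω.map_sum _ _ fun i => L.abs_mem (hα i)]
    exact Finset.sum_congr rfl fun i _ => hω.map_abs (hα i)
  set p := ∑ j, |ω (α j)| with hp
  have hp0 : 0 ≤ p := Finset.sum_nonneg fun i _ => abs_nonneg _
  have hαp : ∀ i, |ω (α i)| ≤ p := fun i =>
    Finset.single_le_sum (f := fun j => |ω (α j)|) (fun j _ => abs_nonneg _) (Finset.mem_univ i)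
  -- The normalized value of `ω` at the tuple. When `p = 0` it defaults to zero, which is harmless
  -- since then every `ω (α i)` vanishes.
  let t : Fin m → ℝ := fun i => ω (α i) / p
  have ht : ∀ i, ω (α i) = p * t i := by
    intro i
    rcases hp0.eq_or_lt with h0 | hpos
    · have := abs_eq_zero.1 (le_antisymm ((hαp i).trans h0.symm.le) (abs_nonneg _))
      rw [this, ← h0, zero_mul]
    · change _ = p * (ω (α i) / p)
      field_simp
  have hgoal : (h.toFun fun i => ω (α i)) = p * h.toFun t := by
    rw [← h.map_smul p t hp0]
    congr 1
    exact funext ht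
  rw [hgoal, ← sub_eq_zero, ← abs_eq_zero]
  refine le_antisymm (le_of_forall_pos_le_add fun ε hε => ?_) (abs_nonneg _)
  obtain ⟨M, hM, hb⟩ := h.germ_bound_sub (l := l) t
    (div_pos hε (lt_of_le_of_lt hp0 (lt_add_one p)))
  have hzL : ∀ i, |α i - t i • (∑ j, |α j|)| ∈ L := fun i =>
    L.abs_mem (sub_mem (hα i) (SMulMemClass.smul_mem _ hpL))
  have hSL : ∑ i, |α i - t i • (∑ j, |α j|)| ∈ L := sum_mem fun i _ => hzL i
  -- By the choice of `t`, `ω` kills the term with the uncontrolled constant `M`, leaving an error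
  -- of at most `ε p / (p + 1)`.
  have hz : ω (∑ i, |α i - t i • (∑ j, |α j|)|) = 0 := by
    rw [hω.map_sum _ _ hzL]
    refine Finset.sum_eq_zero fun i _ => ?_
    rw [hω.map_abs (sub_mem (hα i) (SMulMemClass.smul_mem _ hpL)),
      hω.map_sub (hα i) (SMulMemClass.smul_mem _ hpL), hω.map_smul _ _ hpL, hωp, ht i,
      smul_eq_mul, mul_comm, sub_self, abs_zero]
  have h1 := hω.map_le (L.abs_mem (sub_mem hL (SMulMemClass.smul_mem _ hpL)))
    (add_mem (SMulMemClass.smul_mem _ hpL) (SMulMemClass.smul_mem _ hSL)) (hb α)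
  rw [hω.map_abs (sub_mem hL (SMulMemClass.smul_mem _ hpL)),
    hω.map_sub hL (SMulMemClass.smul_mem _ hpL), hω.map_smul _ _ hpL, hωp,
    hω.map_add _ (SMulMemClass.smul_mem _ hpL) _ (SMulMemClass.smul_mem _ hSL),
    hω.map_smul _ _ hpL, hωp, hω.map_smul _ _ hSL, hz, smul_zero, add_zero, smul_eq_mul,
    smul_eq_mul, mul_comm (h.toFun t)] at h1
  refine h1.trans ?_
  rw [zero_add, div_mul_eq_mul_div, div_le_iff₀ (by linarith)]
  nlinarith

variable [CountableInterFilter l] {G : Type*} [AddCommGroup G] [Lattice G] [Module ℝ G]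

/-- Homomorphisms into spaces of germs commute with positively homogeneous functions. -/
theorem HasValue.map_eq_germ {m : ℕ} {h : PosHomFun m} {a : Fin m → G} {b : G}
    (hv : HasValue h a b) {ψ : G → Germ l ℝ} {L : VectorSublattice G} (hψ : HomOn ψ L)
    (ha : ∀ i, a i ∈ L) (hb : b ∈ L) : ψ b = h.germ fun i => ψ (a i) := by
  set γ := h.germ fun i => ψ (a i)
  by_contra hne
  have hpos : 0 < |ψ b - γ| := lt_of_le_of_ne (abs_nonneg _) fun h0 =>
    hne (sub_eq_zero.1 (abs_eq_zero_vl.1 h0.symm))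
  -- Germs are Archimedean, so a real homomorphism `ω` on the sublattice generated by these finitely
  -- many germs detects the difference. But `ω ∘ ψ` and `ω` both compute the value through `h`.
  let C : Set (Germ l ℝ) := insert |ψ b - γ| (insert γ (insert (ψ b) (Set.range fun i => ψ (a i))))
  have hC : C.Countable := (((Set.countable_range _).insert _).insert _).insert _
  obtain ⟨ω, hω, h1⟩ := exists_homOn_ne_zero hC (Set.mem_insert _ _) hpos
  have hγC : γ ∈ VectorSublattice.generated C := VectorSublattice.subset_generated C (by simp [C])
  have hbC : ψ b ∈ VectorSublattice.generated C := VectorSublattice.subset_generated C (by simp [C])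
  have haC : ∀ i, ψ (a i) ∈ VectorSublattice.generated C := fun i =>
    VectorSublattice.subset_generated C (by simp [C])
  have hcomp : HomOn (ω ∘ ψ) (hψ.preimage (VectorSublattice.generated C)) :=
    hω.comp (hψ.mono fun x hx => hx.1) fun x hx => hx.2
  have h2 : ω (ψ b) = h.toFun fun i => ω (ψ (a i)) :=
    hv.apply_eq hcomp (fun i => ⟨ha i, haC i⟩) ⟨hb, hbC⟩
  have h3 : ω γ = h.toFun fun i => ω (ψ (a i)) := hω.apply_germ h haC hγC
  rw [hω.map_abs (sub_mem hbC hγC), hω.map_sub hbC hγC, h2, h3, sub_self, abs_zero] at h1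
  exact zero_ne_one h1

end GermCalculus

/-! ### Induction over the stages of the functional completion -/

section Stages

variable {E G : Type*} [AddCommGroup E] [Lattice E] [Module ℝ E]
  [AddCommGroup G] [Lattice G] [Module ℝ G] {D : Set AnyPosHomFun} {φ : VLHom E G}

/-- Induction over the stages. The closure condition is only demanded inside the functional
completion, so `Q` may be defined by a map that is a homomorphism only there. -/
theorem mem_of_mem_functionalCompletion (Q : VectorSublattice G) (hφ : ∀ x, φ x ∈ Q)
    (hQ : ∀ h ∈ D, ∀ (a : Fin h.1 → G) (b : G), (∀ i, a i ∈ Q) →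
      (∀ i, a i ∈ functionalCompletion D φ) → b ∈ functionalCompletion D φ →
      HasValue h.2 a b → b ∈ Q) {x : G} (hx : x ∈ functionalCompletion D φ) : x ∈ Q := by
  obtain ⟨n, hn⟩ := hx
  induction n generalizing x with
  | zero => obtain ⟨y, rfl⟩ := hn; exact hφ y
  | succ n ih =>
    refine VectorSublattice.generated_le ?_ hn
    rintro b (hb | ⟨h, hh, a, ha, hv⟩)
    · exact ih hb
    · refine hQ h hh a b (fun i => ih (ha i)) (fun i => ⟨n, ha i⟩) ⟨n + 1, ?_⟩ hv
      exact VectorSublattice.subset_generated _ (Or.inr ⟨h, hh, a, ha, hv⟩)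

theorem map_mem_functionalCompletion (x : E) : φ x ∈ functionalCompletion D φ := ⟨0, x, rfl⟩

/-- No stage leaves the order ideal generated by `φ(E)`: the pointwise bound `|h(a)| ≤ K ∑ |a i|`
holds in the germs of `G` and descends to `G`. -/
theorem exists_dominating [ArchimedeanVectorLattice E] [ArchimedeanVectorLattice G] {x : G}
    (hx : x ∈ functionalCompletion D φ) : ∃ e : E, 0 ≤ e ∧ |x| ≤ φ e := by
  let Q : VectorSublattice G :=
    { carrier := {x | ∃ e : E, 0 ≤ e ∧ |x| ≤ φ e}
      add_mem' := fun {x y} ⟨e, he, h⟩ ⟨f, hf, h'⟩ => ⟨e + f, add_nonneg he hf, by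
        rw [φ.map_add]; exact (abs_add_le_vl x y).trans (add_le_add h h')⟩
      zero_mem' := ⟨0, le_rfl, by rw [φ.map_zero, abs_eq_zero_vl.2 rfl]⟩
      smul_mem' := fun r x ⟨e, he, h⟩ => ⟨|r| • e, smul_nonneg (abs_nonneg r) he, by
        rw [φ.map_smul, abs_smul_vl]; exact smul_le_smul_of_nonneg_left h (abs_nonneg r)⟩
      sup_mem' := fun {x y} ⟨e, he, h⟩ ⟨f, hf, h'⟩ => ⟨e ⊔ f, he.trans le_sup_left, by
        rw [φ.map_sup]
        refine sup_le (sup_le_sup ((le_abs_self x).trans h) ((le_abs_self y).trans h')) ?_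
        rw [neg_sup]
        exact inf_le_left.trans (((neg_le_abs x).trans h).trans le_sup_left)⟩
      inf_mem' := fun {x y} ⟨e, he, h⟩ ⟨f, hf, h'⟩ => ⟨e ⊔ f, he.trans le_sup_left, by
        rw [φ.map_sup]
        refine sup_le (inf_le_left.trans (((le_abs_self x).trans h).trans le_sup_left)) ?_
        rw [neg_inf]
        exact sup_le_sup ((neg_le_abs x).trans h) ((neg_le_abs y).trans h')⟩ }
  refine mem_of_mem_functionalCompletion Q (fun x => ⟨|x|, abs_nonneg x, ?_⟩) ?_ hx
  · rw [φ.map_abs]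
  · intro h _ a b ha _ _ hv
    choose e he hae using ha
    obtain ⟨K, hK, hb⟩ := h.2.germ_bound (l := evalFilter G)
    refine ⟨K • ∑ i, e i, smul_nonneg hK (Finset.sum_nonneg fun i _ => he i), ?_⟩
    have huniv : ∀ x : G, x ∈ VectorSublattice.generated (Set.univ : Set G) := fun x =>
      VectorSublattice.subset_generated _ trivial
    have h1 := hv.map_eq_germ ((evalGerm G).homOn _) (fun i => huniv (a i)) (huniv b)
    have h2 : |b| ≤ K • ∑ i, |a i| := by
      apply VLHom.le_of_map_le evalGerm_injective
      rw [VLHom.map_abs, h1, VLHom.map_smul]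
      refine (hb _).trans_eq ?_
      rw [((evalGerm G).homOn _).map_sum _ _ fun i => huniv |a i|]
      simp only [VLHom.map_abs]
    refine h2.trans ?_
    rw [φ.map_smul]
    refine smul_le_smul_of_nonneg_left ?_ hK
    rw [(φ.homOn (VectorSublattice.generated Set.univ)).map_sum _ _
      fun i => VectorSublattice.subset_generated _ trivial]
    exact Finset.sum_le_sum fun i _ => hae i

variable {X : Type*} {l : Filter X} [CountableInterFilter l]

/-- The image of `h(a)` is forced by the images of the `a i`, so agreement propagates through the
stages. Extension by zero only serves to apply the calculus of `G`. -/
theorem eq_of_eq_on_range {ψ ψ' : VLHom (functionalCompletion D φ) (Germ l ℝ)}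
    (h : ∀ x, ψ (toFunctionalCompletion D φ x) = ψ' (toFunctionalCompletion D φ x)) : ψ = ψ' := by
  refine VLHom.ext fun x => ?_
  let B := functionalCompletion D φ
  have h1 := B.homOn_extendZero ψ
  have h2 := B.homOn_extendZero ψ'
  have key : (x : G) ∈ h1.eqLocus h2 := by
    refine mem_of_mem_functionalCompletion (h1.eqLocus h2) ?_ ?_ x.2
    · intro y
      refine ⟨map_mem_functionalCompletion y, ?_⟩
      rw [B.extendZero_apply _ (map_mem_functionalCompletion y),
        B.extendZero_apply _ (map_mem_functionalCompletion y)]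
      exact h y
    · intro f _ a b ha haB hb hv
      refine ⟨hb, ?_⟩
      rw [hv.map_eq_germ h1 haB hb, hv.map_eq_germ h2 haB hb]
      congr 1
      exact funext fun i => (ha i).2
  have := key.2
  rwa [B.extendZero_apply _ x.2, B.extendZero_apply _ x.2] at this

/-- If the images of the `a i` come from `c i` in `F`, then `h(c)` exists in `F` by
`D`-completeness, and both `h(a)` and `h(c)` go to the same pointwise value. -/
theorem mem_range_of_mem_range {F : Type*} [AddCommGroup F] [Lattice F] [Module ℝ F]
    (hF : IsFunctionallyComplete D F) (J : VLHom F (Germ l ℝ))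
    (ψ : VLHom (functionalCompletion D φ) (Germ l ℝ))
    (h : ∀ x, ψ (toFunctionalCompletion D φ x) ∈ J.range) (x : functionalCompletion D φ) :
    ψ x ∈ J.range := by
  let B := functionalCompletion D φ
  have h1 := B.homOn_extendZero ψ
  have key : (x : G) ∈ h1.preimage J.range := by
    refine mem_of_mem_functionalCompletion (h1.preimage J.range) ?_ ?_ x.2
    · intro y
      refine ⟨map_mem_functionalCompletion y, ?_⟩
      rw [B.extendZero_apply _ (map_mem_functionalCompletion y)]
      exact h y
    · intro f hf a b ha haB hb hv
      refine ⟨hb, ?_⟩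
      choose c hc using fun i => (ha i).2
      obtain ⟨d, hd⟩ := hF f hf c
      refine ⟨d, ?_⟩
      have huniv : ∀ x : F, x ∈ VectorSublattice.generated (Set.univ : Set F) := fun x =>
        VectorSublattice.subset_generated _ trivial
      rw [hv.map_eq_germ h1 haB hb]
      refine (hd.map_eq_germ (J.homOn _) (fun i => huniv (c i)) (huniv d)).trans ?_
      congr 1
      exact funext hc
  have := key.2
  rwa [B.extendZero_apply _ x.2] at this

end Stages

/-! ### Extension of multimorphisms -/

section MultilinearInduction

variable {s : ℕ} {B : Fin s → Type*} [∀ k, AddCommGroup (B k)] [∀ k, Lattice (B k)]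
  [∀ k, Module ℝ (B k)] [∀ k, ArchimedeanVectorLattice (B k)]
  {M : Type*} [AddCommGroup M] [Module ℝ M]

theorem MultilinearMap.map_update_eq_sub (S : MultilinearMap ℝ B M) (x : ∀ k, B k) (k : Fin s)
    (a : B k) : S (Function.update x k a) =
      S (Function.update x k (a ⊔ 0)) - S (Function.update x k (-a ⊔ 0)) := by
  rw [← S.map_update_sub]
  congr 2
  have := posPart_sub_negPart a
  rw [posPart_def, negPart_def] at this
  exact this.symm

/-- Split one coordinate at a time into positive and negative parts; `J` collects the coordinates of
unrestricted sign. -/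
theorem MultilinearMap.mem_of_mem_nonneg (S : MultilinearMap ℝ B M) (N : Submodule ℝ M)
    (h : ∀ x : ∀ k, B k, (∀ k, 0 ≤ x k) → S x ∈ N) (x : ∀ k, B k) : S x ∈ N := by
  have key : ∀ (J : Finset (Fin s)) (x : ∀ k, B k), (∀ k, k ∉ J → 0 ≤ x k) → S x ∈ N := by
    intro J
    induction J using Finset.induction_on with
    | empty => exact fun x hx => h x fun k => hx k (by simp)
    | insert k J hk ih =>
      intro x hx
      have hupd : ∀ a : B k, 0 ≤ a → S (Function.update x k a) ∈ N := by
        intro a ha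
        apply ih
        intro j hj
        by_cases hjk : j = k
        · subst hjk; simpa using ha
        · rw [Function.update_of_ne hjk]
          exact hx j (by simp [hjk, hj])
      rw [← Function.update_eq_self k x, S.map_update_eq_sub]
      exact N.sub_mem (hupd _ le_sup_right) (hupd _ le_sup_right)
  exact key Finset.univ x fun k hk => (hk (Finset.mem_univ k)).elim

/-- Coordinates are released from `A k` one at a time while all stay positive, because only at
positive tuples are the slices of a multimorphism homomorphisms. Closure of `A k` under positive and
negative parts keeps the generators usable under this restriction. -/
theorem MultilinearMap.mem_of_mem_generators (S : MultilinearMap ℝ B M) (N : Submodule ℝ M)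
    (A : ∀ k, Set (B k)) (hA : ∀ k, ∀ a ∈ A k, a ⊔ 0 ∈ A k ∧ -a ⊔ 0 ∈ A k)
    (h0 : ∀ x : ∀ k, B k, (∀ k, x k ∈ A k) → S x ∈ N)
    (h1 : ∀ (k : Fin s) (x : ∀ k, B k), (∀ j, 0 ≤ x j) →
      (∀ a ∈ A k, S (Function.update x k a) ∈ N) → ∀ b, S (Function.update x k b) ∈ N)
    (x : ∀ k, B k) : S x ∈ N := by
  have key : ∀ (J : Finset (Fin s)) (x : ∀ k, B k), (∀ k, 0 ≤ x k) → (∀ k, k ∉ J → x k ∈ A k) →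
      S x ∈ N := by
    intro J
    induction J using Finset.induction_on with
    | empty => exact fun x _ hx => h0 x fun k => hx k (by simp)
    | insert k J hk ih =>
      intro x hx0 hx
      have hupd : ∀ a : B k, 0 ≤ a → a ∈ A k → S (Function.update x k a) ∈ N := by
        intro a ha haA
        apply ih
        · intro j
          by_cases hjk : j = k
          · subst hjk; simpa using ha
          · rw [Function.update_of_ne hjk]; exact hx0 j
        · intro j hj
          by_cases hjk : j = k
          · subst hjk; simpa using haA
          · rw [Function.update_of_ne hjk]
            exact hx j (by simp [hjk, hj])
      rw [← Function.update_eq_self k x]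
      refine h1 k x hx0 (fun a ha => ?_) (x k)
      rw [S.map_update_eq_sub]
      exact N.sub_mem (hupd _ le_sup_right (hA k a ha).1) (hupd _ le_sup_right (hA k a ha).2)
  exact S.mem_of_mem_nonneg N
    (fun x hx => key Finset.univ x hx fun k hk => (hk (Finset.mem_univ k)).elim) x

end MultilinearInduction

/-! ### Proportional slices and the product formula -/

section Multimorphism

variable {s : ℕ} {E : Fin s → Type*} {F : Type*}
    [∀ k, AddCommGroup (E k)] [∀ k, Lattice (E k)] [∀ k, Module ℝ (E k)]
    [∀ k, ArchimedeanVectorLattice (E k)]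
    [AddCommGroup F] [Lattice F] [Module ℝ F] [ArchimedeanVectorLattice F]
    {T : MultilinearMap ℝ E F}

/-- The homomorphism obtained by fixing all variables but one at positive elements. -/
def IsVLMultimorphism.slice (hT : IsVLMultimorphism T) {e : ∀ k, E k} (he : ∀ k, 0 ≤ e k)
    (k : Fin s) : VLHom (E k) F :=
  ⟨T.toLinearMap e k, hT k e fun j _ => he j⟩

theorem IsVLMultimorphism.slice_apply (hT : IsVLMultimorphism T) {e : ∀ k, E k}
    (he : ∀ k, 0 ≤ e k) (k : Fin s) (x : E k) :
    hT.slice he k x = T (Function.update e k x) := rfl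

omit [∀ k, ArchimedeanVectorLattice (E k)] in
theorem update_nonneg {e : ∀ k, E k} (he : ∀ k, 0 ≤ e k) {k : Fin s} {x : E k} (hx : 0 ≤ x)
    (j : Fin s) : 0 ≤ Function.update e k x j := by
  by_cases hjk : j = k
  · subst hjk; simpa using hx
  · rw [Function.update_of_ne hjk]; exact he j

omit [∀ k, ArchimedeanVectorLattice (E k)] in
theorem update_le {f e : ∀ k, E k} (hfe : ∀ k, f k ≤ e k) {k : Fin s} {x y : E k} (hx : x ≤ y)
    (j : Fin s) : Function.update f k x j ≤ Function.update e k y j := by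
  by_cases hjk : j = k
  · subst hjk; simpa using hx
  · rw [Function.update_of_ne hjk, Function.update_of_ne hjk]; exact hfe j

/-- Raise the coordinates from `f` to `e` one at a time; each step is a positive slice. -/
theorem IsVLMultimorphism.map_le (hT : IsVLMultimorphism T) {f e : ∀ k, E k} (hf : ∀ k, 0 ≤ f k)
    (hfe : ∀ k, f k ≤ e k) : T f ≤ T e := by
  have key : ∀ J : Finset (Fin s), T f ≤ T (J.piecewise e f) := by
    intro J
    induction J using Finset.induction_on with
    | empty => simp
    | insert k J hk ih =>
      rw [Finset.piecewise_insert]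
      refine ih.trans ?_
      set g := J.piecewise e f
      have hg : ∀ j, 0 ≤ g j := by
        intro j
        by_cases hj : j ∈ J
        · simpa [g, hj] using (hf j).trans (hfe j)
        · simpa [g, hj] using hf j
      have hgk : g k = f k := by simp [g, hk]
      conv_lhs => rw [← Function.update_eq_self k g]
      rw [← hT.slice_apply hg, ← hT.slice_apply hg, hgk]
      exact (hT.slice hg k).map_le (hfe k)
  simpa using key Finset.univ

theorem IsVLMultimorphism.map_nonneg (hT : IsVLMultimorphism T) (hs : 1 ≤ s) {f : ∀ k, E k}
    (hf : ∀ k, 0 ≤ f k) : 0 ≤ T f := by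
  let k : Fin s := ⟨0, hs⟩
  rw [← Function.update_eq_self k f, ← hT.slice_apply hf]
  exact (hT.slice hf k).map_nonneg (hf k)

/-- At a point `ω`, the coefficients `r = ω q'` and `t = -ω p'` make the right side vanish, and the
left side is then the wanted determinant. -/
theorem evalGerm_mul_comm_of_abs_le {p q p' q' : F}
    (h : ∀ r t : ℝ, |r • p + t • q| ≤ |r • p' + t • q'|) :
    evalGerm F p * evalGerm F q' = evalGerm F q * evalGerm F p' := by
  refine Germ.coe_eq.2 ?_
  filter_upwards [eventually_homOn (C := {p, q, p', q'}) (Set.toFinite _).countable] with ω hω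
  have mp := VectorSublattice.subset_generated ({p, q, p', q'} : Set F) (show p ∈ _ by simp)
  have mq := VectorSublattice.subset_generated ({p, q, p', q'} : Set F) (show q ∈ _ by simp)
  have mp' := VectorSublattice.subset_generated ({p, q, p', q'} : Set F) (show p' ∈ _ by simp)
  have mq' := VectorSublattice.subset_generated ({p, q, p', q'} : Set F) (show q' ∈ _ by simp)
  set L := VectorSublattice.generated ({p, q, p', q'} : Set F)
  have hsm : ∀ (r : ℝ) {x : F}, x ∈ L → r • x ∈ L := fun r x hx => SMulMemClass.smul_mem r hx
  have h1 := hω.map_le (L.abs_mem (add_mem (hsm (ω q') mp) (hsm (-ω p') mq)))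
    (L.abs_mem (add_mem (hsm (ω q') mp') (hsm (-ω p') mq'))) (h (ω q') (-ω p'))
  rw [hω.map_abs (add_mem (hsm _ mp) (hsm _ mq)), hω.map_abs (add_mem (hsm _ mp') (hsm _ mq')),
    hω.map_add _ (hsm _ mp) _ (hsm _ mq), hω.map_add _ (hsm _ mp') _ (hsm _ mq'),
    hω.map_smul _ _ mp, hω.map_smul _ _ mq, hω.map_smul _ _ mp', hω.map_smul _ _ mq'] at h1
  simp only [smul_eq_mul] at h1
  have h2 : ω q' * ω p' + -ω p' * ω q' = 0 := by ring
  rw [h2, abs_zero] at h1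
  have h3 := abs_eq_zero.1 (le_antisymm h1 (abs_nonneg _))
  change ω p * ω q' = ω q * ω p'
  linarith

/-- Slices of a multimorphism at comparable positive elements are locally proportional. -/
theorem IsVLMultimorphism.evalGerm_slice_mul (hT : IsVLMultimorphism T) {f e : ∀ k, E k}
    (hf : ∀ k, 0 ≤ f k) (hfe : ∀ k, f k ≤ e k) (k : Fin s) (x y : E k) :
    evalGerm F (T (Function.update f k x)) * evalGerm F (T (Function.update e k y)) =
      evalGerm F (T (Function.update f k y)) * evalGerm F (T (Function.update e k x)) := by
  have he : ∀ k, 0 ≤ e k := fun k => (hf k).trans (hfe k)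
  -- For `z = r x + t y`, the absolute value of the slice at `f` is its value at `|z|`, which
  -- monotonicity of `T` bounds by that of the slice at `e`.
  apply evalGerm_mul_comm_of_abs_le
  intro r t
  rw [← hT.slice_apply hf, ← hT.slice_apply hf, ← hT.slice_apply he, ← hT.slice_apply he,
    ← VLHom.map_smul, ← VLHom.map_smul, ← VLHom.map_smul, ← VLHom.map_smul, ← VLHom.map_add,
    ← VLHom.map_add, ← VLHom.map_abs, ← VLHom.map_abs, hT.slice_apply, hT.slice_apply]
  exact hT.map_le (update_nonneg hf (abs_nonneg _)) (update_le hfe le_rfl)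

/-- Replacing `e k` by `f k` in one more coordinate multiplies by the ratio `T(e₁, …, fₖ, …, eₛ) /
T(e)`, the same as if the other coordinates were those of `e`, because slices are proportional. -/
theorem IsVLMultimorphism.evalGerm_piecewise (hT : IsVLMultimorphism T) {f e : ∀ k, E k}
    (hf : ∀ k, 0 ≤ f k) (hfe : ∀ k, f k ≤ e k) (J : Finset (Fin s)) (hJ : J.Nonempty) :
    evalGerm F (T (J.piecewise f e)) * evalGerm F (T e) ^ (J.card - 1) =
      ∏ k ∈ J, evalGerm F (T (Function.update e k (f k))) := by
  induction hJ using Finset.Nonempty.cons_induction with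
  | singleton k => simp [Finset.piecewise_singleton]
  | cons k J hk hJ ih =>
    rw [Finset.prod_cons, ← ih, Finset.card_cons, Finset.cons_eq_insert, Finset.piecewise_insert]
    set g := J.piecewise f e
    have hg : ∀ j, 0 ≤ g j := by
      intro j
      by_cases hj : j ∈ J
      · simpa [g, hj] using hf j
      · simpa [g, hj] using (hf j).trans (hfe j)
    have hge : ∀ j, g j ≤ e j := by
      intro j
      by_cases hj : j ∈ J
      · simpa [g, hj] using hfe j
      · simp [g, hj]
    have hgk : Function.update g k (e k) = g := by
      rw [Function.update_eq_self_iff]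
      simp [g, hk]
    have h1 := hT.evalGerm_slice_mul hg hge k (f k) (e k)
    rw [hgk, Function.update_eq_self] at h1
    have hc : J.card + 1 - 1 = (J.card - 1) + 1 := by
      have := hJ.card_pos
      omega
    rw [hc, pow_succ]
    linear_combination (evalGerm F (T e) ^ (J.card - 1)) * h1

theorem IsVLMultimorphism.evalGerm_mul_pow (hT : IsVLMultimorphism T) (hs : 1 ≤ s)
    {f e : ∀ k, E k} (hf : ∀ k, 0 ≤ f k) (hfe : ∀ k, f k ≤ e k) :
    evalGerm F (T f) * evalGerm F (T e) ^ (s - 1) =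
      ∏ k, evalGerm F (T (Function.update e k (f k))) := by
  have := hT.evalGerm_piecewise hf hfe Finset.univ ⟨⟨0, hs⟩, Finset.mem_univ _⟩
  simpa using this

end Multimorphism

/-! ### Pointwise cancellation with zero inverted to zero -/

section RealIdentities

/-- Pointwise form of independence from the dominating tuple: `p`, `p'` are the slices at `e`, `e'`,
while `t = T(e)`, `t' = T(e')` and `d k` is `T(e')` with `e k` in place `k`. If `t = 0`, some `d k`
vanishes, hence `p' k` too, and both sides are zero; otherwise the relations can be divided. The
case `s = 1` is separate since `0 ^ 0 = 1`. -/
theorem prod_mul_inv_pow_eq {s : ℕ} (hs : 1 ≤ s) {p p' d : Fin s → ℝ} {t t' : ℝ}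
    (h1 : ∀ k, p k * d k = t * p' k) (h2 : t * t' ^ (s - 1) = ∏ k, d k)
    (h3 : ∀ k, |p' k| ≤ d k) (h0 : 0 ≤ t) (h4 : t ≤ t') (h5 : s = 1 → p = p') :
    (∏ k, p k) * t⁻¹ ^ (s - 1) = (∏ k, p' k) * t'⁻¹ ^ (s - 1) := by
  rcases hs.eq_or_lt with rfl | hs'
  · simp [h5 rfl]
  have hs0 : s - 1 ≠ 0 := by omega
  rcases h0.eq_or_lt with ht | ht
  · rw [← ht, inv_zero, zero_pow hs0, mul_zero]
    rw [← ht, zero_mul] at h2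
    obtain ⟨k, -, hk⟩ := Finset.prod_eq_zero_iff.1 h2.symm
    have hpk : p' k = 0 := abs_eq_zero.1 (le_antisymm ((h3 k).trans hk.le) (abs_nonneg _))
    rw [Finset.prod_eq_zero (Finset.mem_univ k) hpk, zero_mul]
  · have ht' : 0 < t' := ht.trans_le h4
    have h6 : (∏ k, p k) * ∏ k, d k = t ^ s * ∏ k, p' k := by
      rw [← Finset.prod_mul_distrib]
      simp only [h1, Finset.prod_mul_distrib, Finset.prod_const, Finset.card_univ,
        Fintype.card_fin]
    rw [← h2] at h6
    obtain ⟨n, rfl⟩ : ∃ n, s = n + 1 := ⟨s - 1, by omega⟩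
    simp only [Nat.add_sub_cancel] at h6 ⊢
    rw [pow_succ] at h6
    have h7 : (∏ k, p k) * t' ^ n = t ^ n * ∏ k, p' k :=
      mul_left_cancel₀ ht.ne' (by linear_combination h6)
    rw [inv_pow, inv_pow, ← div_eq_mul_inv, ← div_eq_mul_inv, div_eq_div_iff (by positivity)
      (by positivity)]
    linear_combination h7

theorem mul_pow_mul_inv_pow {n : ℕ} {a t : ℝ} (h0 : 0 ≤ a) (h : a ≤ t) :
    a * t ^ n * t⁻¹ ^ n = a := by
  rcases (h0.trans h).eq_or_lt with ht | ht
  · have : a = 0 := le_antisymm (h.trans ht.symm.le) h0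
    rw [this]; ring
  · rw [inv_pow, mul_assoc, mul_inv_cancel₀ (by positivity), mul_one]

end RealIdentities

section GermIdentities

variable {X : Type*} {l : Filter X}

theorem Filter.Germ.coe_finset_prod {ι : Type*} (s : Finset ι) (f : ι → X → ℝ) :
    ∏ i ∈ s, ((f i : X → ℝ) : Germ l ℝ) = ((fun x => ∏ i ∈ s, f i x : X → ℝ) : Germ l ℝ) := by
  classical
  induction s using Finset.induction_on with
  | empty => rfl
  | insert a s ha ih =>
    rw [Finset.prod_insert ha, ih]
    simp only [Finset.prod_insert ha]
    rfl

theorem Filter.Germ.exists_coe_eq {ι : Type*} (p : ι → Germ l ℝ) :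
    ∃ P : ι → X → ℝ, p = fun k => ((P k : X → ℝ) : Germ l ℝ) :=
  ⟨fun k => Quotient.out (p k), funext fun k => (Germ.coe_quotient_out (p k)).symm⟩

theorem Filter.Germ.prod_mul_inv_pow_eq {s : ℕ} (hs : 1 ≤ s) {p p' d : Fin s → Germ l ℝ} {t t' : Germ l ℝ}
    (h1 : ∀ k, p k * d k = t * p' k) (h2 : t * t' ^ (s - 1) = ∏ k, d k)
    (h3 : ∀ k, |p' k| ≤ d k) (h0 : 0 ≤ t) (h4 : t ≤ t') (h5 : s = 1 → p = p') :
    (∏ k, p k) * t⁻¹ ^ (s - 1) = (∏ k, p' k) * t'⁻¹ ^ (s - 1) := by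
  obtain ⟨P, rfl⟩ := Germ.exists_coe_eq p
  obtain ⟨P', rfl⟩ := Germ.exists_coe_eq p'
  obtain ⟨d, rfl⟩ := Germ.exists_coe_eq d
  induction t, t' using Germ.inductionOn₂ with
  | _ t t' =>
  rw [Germ.coe_finset_prod] at h2 ⊢
  rw [Germ.coe_finset_prod]
  have e1 : ∀ᶠ x in l, ∀ k, P k x * d k x = t x * P' k x :=
    eventually_all.2 fun k => Germ.coe_eq.1 (h1 k)
  have e3 : ∀ᶠ x in l, ∀ k, |P' k x| ≤ d k x := eventually_all.2 fun k => Germ.coe_le.1 (h3 k)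
  have e5 : ∀ᶠ x in l, s = 1 → ∀ k, P k x = P' k x := by
    by_cases hs1 : s = 1
    · have : ∀ᶠ x in l, ∀ k, P k x = P' k x :=
        eventually_all.2 fun k => Germ.coe_eq.1 (congrFun (h5 hs1) k)
      filter_upwards [this] with x hx _ using hx
    · exact Eventually.of_forall fun x hx => (hs1 hx).elim
  have e2 : ∀ᶠ x in l, t x * t' x ^ (s - 1) = ∏ k, d k x := Germ.coe_eq.1 h2
  refine Germ.coe_eq.2 ?_
  filter_upwards [e1, e2, e3, Germ.coe_nonneg.1 h0, Germ.coe_le.1 h4, e5] with x x1 x2 x3 x0 x4 x5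
  exact _root_.prod_mul_inv_pow_eq (p := fun k => P k x) (p' := fun k => P' k x)
    (d := fun k => d k x) hs x1 x2 x3 x0 x4 fun h => funext (x5 h)

theorem Filter.Germ.mul_pow_mul_inv_pow {n : ℕ} {a t : Germ l ℝ} (h0 : 0 ≤ a) (h : a ≤ t) :
    a * t ^ n * t⁻¹ ^ n = a := by
  induction a, t using Germ.inductionOn₂ with
  | _ a t =>
  refine Germ.coe_eq.2 ?_
  filter_upwards [Germ.coe_nonneg.1 h0, Germ.coe_le.1 h] with x x0 x1
  exact _root_.mul_pow_mul_inv_pow x0 x1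

theorem Filter.Germ.inv_nonneg {t : Germ l ℝ} (h : 0 ≤ t) : 0 ≤ t⁻¹ := by
  induction t using Germ.inductionOn with
  | _ t =>
  refine Germ.coe_nonneg.2 ?_
  filter_upwards [Germ.coe_nonneg.1 h] with x hx
  exact _root_.inv_nonneg.2 hx

/-- Multiplication by a positive germ. -/
def Filter.Germ.mulHom (c : Germ l ℝ) (hc : 0 ≤ c) : VLHom (Germ l ℝ) (Germ l ℝ) where
  toLin :=
    { toFun := fun a => a * c
      map_add' := fun a b => add_mul a b c
      map_smul' := fun r a => by
        induction a, c using Germ.inductionOn₂ with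
        | _ f g => exact Germ.coe_eq.2 (Eventually.of_forall fun x => mul_assoc r (f x) (g x)) }
  isLatticeHom a b := by
    induction c using Germ.inductionOn with
    | _ g =>
    induction a, b using Germ.inductionOn₂ with
    | _ f f' =>
    constructor
    · refine Germ.coe_eq.2 ?_
      filter_upwards [Germ.coe_nonneg.1 hc] with x hx
      exact max_mul_of_nonneg _ _ hx
    · refine Germ.coe_eq.2 ?_
      filter_upwards [Germ.coe_nonneg.1 hc] with x hx
      exact min_mul_of_nonneg _ _ hx

theorem Filter.Germ.mulHom_apply (c : Germ l ℝ) (hc : 0 ≤ c) (a : Germ l ℝ) :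
    Germ.mulHom c hc a = a * c := rfl

end GermIdentities

/-! ### Construction and uniqueness of the extension -/

section Extension

variable {s : ℕ} {E G : Fin s → Type*} {F : Type*}
    [∀ k, AddCommGroup (E k)] [∀ k, Lattice (E k)] [∀ k, Module ℝ (E k)]
    [∀ k, ArchimedeanVectorLattice (E k)]
    [∀ k, AddCommGroup (G k)] [∀ k, Lattice (G k)] [∀ k, Module ℝ (G k)]
    [∀ k, ArchimedeanVectorLattice (G k)]
    [AddCommGroup F] [Lattice F] [Module ℝ F] [ArchimedeanVectorLattice F]
    {T : MultilinearMap ℝ E F} {D : Set AnyPosHomFun} {φ : ∀ k, VLHom (E k) (G k)}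
    {ι : ∀ k, VLHom (G k) (Germ (evalFilter (E k)) ℝ)}

/-- The extension to the functional completion of the homomorphism obtained by fixing all variables
but one. -/
def IsVLMultimorphism.sliceExt (hT : IsVLMultimorphism T) (D : Set AnyPosHomFun)
    (φ : ∀ k, VLHom (E k) (G k)) (ι : ∀ k, VLHom (G k) (Germ (evalFilter (E k)) ℝ))
    {e : ∀ k, E k} (he : ∀ k, 0 ≤ e k) (k : Fin s) :
    VLHom (functionalCompletion D (φ k)) (Germ (evalFilter F) ℝ) :=
  ((germMap (hT.slice he k)).comp (ι k)).comp (functionalCompletion D (φ k)).incl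

theorem IsVLMultimorphism.sliceExt_apply (hT : IsVLMultimorphism T)
    (hι : ∀ k x, ι k (φ k x) = evalGerm (E k) x) {e : ∀ k, E k} (he : ∀ k, 0 ≤ e k) (k : Fin s)
    (x : E k) : hT.sliceExt D φ ι he k (toFunctionalCompletion D (φ k) x) =
      evalGerm F (T (Function.update e k x)) := by
  change germMap (hT.slice he k) (ι k (φ k x)) = _
  rw [hι, germMap_evalGerm, hT.slice_apply]

/-- The local formula for the extension of a multimorphism, relative to positive elements `e`. -/
noncomputable def IsVLMultimorphism.localExt (hT : IsVLMultimorphism T) (D : Set AnyPosHomFun)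
    (φ : ∀ k, VLHom (E k) (G k)) (ι : ∀ k, VLHom (G k) (Germ (evalFilter (E k)) ℝ))
    {e : ∀ k, E k} (he : ∀ k, 0 ≤ e k) (x : ∀ k, functionalCompletion D (φ k)) :
    Germ (evalFilter F) ℝ :=
  -- The product formula solved for the value at `x`. The inverse of a germ is pointwise and sends
  -- zero to zero.
  (∏ k, hT.sliceExt D φ ι he k (x k)) * (evalGerm F (T e))⁻¹ ^ (s - 1)

/-- The factor by which `localExt` differs from `sliceExt` in one variable. -/
noncomputable def IsVLMultimorphism.localFactor (hT : IsVLMultimorphism T) (D : Set AnyPosHomFun)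
    (φ : ∀ k, VLHom (E k) (G k)) (ι : ∀ k, VLHom (G k) (Germ (evalFilter (E k)) ℝ))
    {e : ∀ k, E k} (he : ∀ k, 0 ≤ e k) (x : ∀ k, functionalCompletion D (φ k)) (i : Fin s) :
    Germ (evalFilter F) ℝ :=
  (∏ k ∈ Finset.univ.erase i, hT.sliceExt D φ ι he k (x k)) * (evalGerm F (T e))⁻¹ ^ (s - 1)

theorem IsVLMultimorphism.localExt_update (hT : IsVLMultimorphism T)
    {e : ∀ k, E k} (he : ∀ k, 0 ≤ e k) (x : ∀ k, functionalCompletion D (φ k)) (i : Fin s)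
    (a : functionalCompletion D (φ i)) :
    hT.localExt D φ ι he (Function.update x i a) =
      hT.sliceExt D φ ι he i a * hT.localFactor D φ ι he x i := by
  unfold localExt localFactor
  rw [← Finset.mul_prod_erase _ _ (Finset.mem_univ i), Function.update_self, mul_assoc]
  congr 2
  refine Finset.prod_congr rfl fun k hk => ?_
  rw [Function.update_of_ne (Finset.ne_of_mem_erase hk)]

theorem IsVLMultimorphism.localFactor_nonneg (hT : IsVLMultimorphism T) (hs : 1 ≤ s)
    {e : ∀ k, E k} (he : ∀ k, 0 ≤ e k) {x : ∀ k, functionalCompletion D (φ k)}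
    (hx : ∀ k, 0 ≤ x k) (i : Fin s) : 0 ≤ hT.localFactor D φ ι he x i := by
  refine mul_nonneg (Finset.prod_nonneg fun k _ => VLHom.map_nonneg _ (hx k)) (pow_nonneg ?_ _)
  exact Germ.inv_nonneg (VLHom.map_nonneg _ (hT.map_nonneg hs he))

theorem IsVLMultimorphism.localExt_eq_of_le (hT : IsVLMultimorphism T) (hs : 1 ≤ s)
    (hι : ∀ k x, ι k (φ k x) = evalGerm (E k) x)
    {e e' : ∀ k, E k} (he : ∀ k, 0 ≤ e k) (he' : ∀ k, 0 ≤ e' k) (hee' : ∀ k, e k ≤ e' k)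
    {x : ∀ k, functionalCompletion D (φ k)} (hx : ∀ k, |(x k : G k)| ≤ φ k (e k)) :
    hT.localExt D φ ι he x = hT.localExt D φ ι he' x := by
  have hdom : ∀ k, |x k| ≤ toFunctionalCompletion D (φ k) (e k) := fun k => hx k
  have hd0 : ∀ k, 0 ≤ evalGerm F (T (Function.update e' k (e k))) := fun k =>
    VLHom.map_nonneg _ (hT.map_nonneg hs (update_nonneg he' (he k)))
  have ht0 : 0 ≤ evalGerm F (T e) := VLHom.map_nonneg _ (hT.map_nonneg hs he)
  refine Germ.prod_mul_inv_pow_eq (d := fun k => evalGerm F (T (Function.update e' k (e k))))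
    hs ?_ (hT.evalGerm_mul_pow hs he hee') ?_ ht0 (VLHom.map_le _ (hT.map_le he hee')) ?_
  · intro k
    -- Multiplication by a positive germ is a homomorphism, so the proportionality of slices, known
    -- on `E k`, extends to the functional completion.
    have h1 : (Germ.mulHom _ (hd0 k)).comp (hT.sliceExt D φ ι he k) =
        (Germ.mulHom _ ht0).comp (hT.sliceExt D φ ι he' k) := by
      apply eq_of_eq_on_range
      intro y
      rw [VLHom.comp_apply, VLHom.comp_apply, Germ.mulHom_apply, Germ.mulHom_apply,
        hT.sliceExt_apply hι, hT.sliceExt_apply hι, hT.evalGerm_slice_mul he hee' k y (e k),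
        Function.update_eq_self, mul_comm]
    have h2 := DFunLike.congr_fun h1 (x k)
    rw [VLHom.comp_apply, VLHom.comp_apply, Germ.mulHom_apply, Germ.mulHom_apply] at h2
    rw [h2, mul_comm]
  · intro k
    rw [← VLHom.map_abs]
    refine (VLHom.map_le _ (hdom k)).trans_eq ?_
    rw [hT.sliceExt_apply hι]
  · rintro rfl
    funext k
    have h1 : hT.sliceExt D φ ι he k = hT.sliceExt D φ ι he' k := by
      apply eq_of_eq_on_range
      intro y
      rw [hT.sliceExt_apply hι, hT.sliceExt_apply hι]
      congr 2
      funext j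
      obtain rfl := Subsingleton.elim k j
      simp
    rw [h1]

theorem IsVLMultimorphism.localExt_toFunctionalCompletion (hT : IsVLMultimorphism T) (hs : 1 ≤ s)
    (hι : ∀ k x, ι k (φ k x) = evalGerm (E k) x)
    {f e : ∀ k, E k} (hf : ∀ k, 0 ≤ f k) (he : ∀ k, 0 ≤ e k) (hfe : ∀ k, f k ≤ e k) :
    hT.localExt D φ ι he (fun k => toFunctionalCompletion D (φ k) (f k)) = evalGerm F (T f) := by
  unfold localExt
  simp only [hT.sliceExt_apply hι]
  rw [← hT.evalGerm_mul_pow hs hf hfe]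
  exact Germ.mul_pow_mul_inv_pow (VLHom.map_nonneg _ (hT.map_nonneg hs hf))
    (VLHom.map_le _ (hT.map_le hf hfe))

/-- A positive element of `E k` dominating a given element of the functional completion. -/
noncomputable def dominator (x : ∀ k, functionalCompletion D (φ k)) (k : Fin s) : E k :=
  (exists_dominating (x k).2).choose

theorem dominator_nonneg (x : ∀ k, functionalCompletion D (φ k)) (k : Fin s) :
    0 ≤ dominator x k := (exists_dominating (x k).2).choose_spec.1

theorem abs_le_dominator (x : ∀ k, functionalCompletion D (φ k)) (k : Fin s) :
    |(x k : G k)| ≤ φ k (dominator x k) := (exists_dominating (x k).2).choose_spec.2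

/-- The extension of a multimorphism, with values in germs. -/
noncomputable def IsVLMultimorphism.germExt (hT : IsVLMultimorphism T) (D : Set AnyPosHomFun)
    (φ : ∀ k, VLHom (E k) (G k)) (ι : ∀ k, VLHom (G k) (Germ (evalFilter (E k)) ℝ))
    (x : ∀ k, functionalCompletion D (φ k)) : Germ (evalFilter F) ℝ :=
  hT.localExt D φ ι (dominator_nonneg x) x

theorem IsVLMultimorphism.germExt_eq (hT : IsVLMultimorphism T) (hs : 1 ≤ s)
    (hι : ∀ k x, ι k (φ k x) = evalGerm (E k) x) {e : ∀ k, E k} (he : ∀ k, 0 ≤ e k)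
    {x : ∀ k, functionalCompletion D (φ k)} (hx : ∀ k, dominator x k ≤ e k) :
    hT.germExt D φ ι x = hT.localExt D φ ι he x :=
  hT.localExt_eq_of_le hs hι _ he hx (abs_le_dominator x)

/-- A common dominating tuple for three values of one coordinate. Additivity, homogeneity and the
lattice identities in that coordinate thereby reduce to those of a single extended slice times a
fixed factor. -/
theorem IsVLMultimorphism.germExt_update (hT : IsVLMultimorphism T) (hs : 1 ≤ s)
    (hι : ∀ k x, ι k (φ k x) = evalGerm (E k) x) (x : ∀ k, functionalCompletion D (φ k))
    (i : Fin s) (a b c : functionalCompletion D (φ i)) :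
    ∃ (e : ∀ k, E k) (he : ∀ k, 0 ≤ e k), ∀ y, y = a ∨ y = b ∨ y = c →
      hT.germExt D φ ι (Function.update x i y) =
        hT.sliceExt D φ ι he i y * hT.localFactor D φ ι he x i := by
  let e : ∀ k, E k := fun k => dominator (Function.update x i a) k ⊔
    dominator (Function.update x i b) k ⊔ dominator (Function.update x i c) k
  have he : ∀ k, 0 ≤ e k := fun k => (dominator_nonneg _ k).trans le_sup_right
  refine ⟨e, he, fun y hy => ?_⟩
  rw [← hT.localExt_update]
  apply hT.germExt_eq hs hι
  intro k
  rcases hy with rfl | rfl | rfl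
  · exact le_sup_left.trans le_sup_left
  · exact le_sup_right.trans le_sup_left
  · exact le_sup_right

/-- The extension of a multimorphism, with values in germs, as a multilinear map. -/
noncomputable def IsVLMultimorphism.germExtMultilinear (hT : IsVLMultimorphism T) (hs : 1 ≤ s)
    (hι : ∀ k x, ι k (φ k x) = evalGerm (E k) x) (D : Set AnyPosHomFun) :
    MultilinearMap ℝ (fun k => functionalCompletion D (φ k)) (Germ (evalFilter F) ℝ) where
  toFun := hT.germExt D φ ι
  map_update_add' := by
    intro inst x i a b
    obtain rfl : inst = instDecidableEqFin s := Subsingleton.elim _ _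
    obtain ⟨e, he, h⟩ := hT.germExt_update hs hι x i a b (a + b)
    rw [h a (by simp), h b (by simp), h (a + b) (by simp), VLHom.map_add, add_mul]
  map_update_smul' := by
    intro inst x i r a
    obtain rfl : inst = instDecidableEqFin s := Subsingleton.elim _ _
    obtain ⟨e, he, h⟩ := hT.germExt_update hs hι x i a a (r • a)
    rw [h a (by simp), h (r • a) (by simp), VLHom.map_smul]
    generalize hT.sliceExt D φ ι he i a = p
    generalize hT.localFactor D φ ι he x i = q
    induction p, q using Germ.inductionOn₂ with
    | _ p q => exact Germ.coe_eq.2 (Eventually.of_forall fun ω => mul_assoc r (p ω) (q ω))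

theorem IsVLMultimorphism.isLatticeHom_germExtMultilinear (hT : IsVLMultimorphism T)
    (hs : 1 ≤ s) (hι : ∀ k x, ι k (φ k x) = evalGerm (E k) x) (D : Set AnyPosHomFun)
    {x : ∀ k, functionalCompletion D (φ k)} (hx : ∀ k, 0 ≤ x k) (i : Fin s) :
    IsLatticeHom ((hT.germExtMultilinear hs hι D).toLinearMap x i) := by
  intro a b
  have key : ∀ {e : ∀ k, E k} (he : ∀ k, 0 ≤ e k) (y : functionalCompletion D (φ i)),
      hT.sliceExt D φ ι he i y * hT.localFactor D φ ι he x i =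
        (Germ.mulHom _ (hT.localFactor_nonneg hs he hx i)).comp (hT.sliceExt D φ ι he i) y :=
    fun _ _ => rfl
  constructor
  · obtain ⟨e, he, h⟩ := hT.germExt_update hs hι x i a b (a ⊔ b)
    change hT.germExt D φ ι _ = hT.germExt D φ ι _ ⊔ hT.germExt D φ ι _
    rw [h a (by simp), h b (by simp), h (a ⊔ b) (by simp), key, key, key, VLHom.map_sup]
  · obtain ⟨e, he, h⟩ := hT.germExt_update hs hι x i a b (a ⊓ b)
    change hT.germExt D φ ι _ = hT.germExt D φ ι _ ⊓ hT.germExt D φ ι _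
    rw [h a (by simp), h b (by simp), h (a ⊓ b) (by simp), key, key, key, VLHom.map_inf]

theorem toFunctionalCompletion_posPart (D : Set AnyPosHomFun) (k : Fin s) (x : E k) :
    toFunctionalCompletion D (φ k) x ⊔ 0 = toFunctionalCompletion D (φ k) (x ⊔ 0) := by
  apply Subtype.ext
  change φ k x ⊔ 0 = φ k (x ⊔ 0)
  rw [VLHom.map_sup, VLHom.map_zero]

theorem toFunctionalCompletion_negPart (D : Set AnyPosHomFun) (k : Fin s) (x : E k) :
    -toFunctionalCompletion D (φ k) x ⊔ 0 = toFunctionalCompletion D (φ k) (-x ⊔ 0) := by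
  apply Subtype.ext
  change -φ k x ⊔ 0 = φ k (-x ⊔ 0)
  rw [VLHom.map_sup, VLHom.map_zero, VLHom.map_neg]

/-- The canonical map into the functional completion, as a linear map. -/
def toFunctionalCompletionLinear (D : Set AnyPosHomFun) (k : Fin s) :
    E k →ₗ[ℝ] functionalCompletion D (φ k) where
  toFun := toFunctionalCompletion D (φ k)
  map_add' x y := Subtype.ext ((φ k).map_add x y)
  map_smul' r x := Subtype.ext ((φ k).map_smul r x)

/-- On positive tuples this is the product formula. The difference of the two sides is multilinear,
so it vanishes on all tuples. -/
theorem IsVLMultimorphism.germExt_toFunctionalCompletion (hT : IsVLMultimorphism T) (hs : 1 ≤ s)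
    (hι : ∀ k x, ι k (φ k x) = evalGerm (E k) x) (f : ∀ k, E k) :
    hT.germExt D φ ι (fun k => toFunctionalCompletion D (φ k) (f k)) = evalGerm F (T f) := by
  let U : MultilinearMap ℝ E (Germ (evalFilter F) ℝ) :=
    (hT.germExtMultilinear hs hι D).compLinearMap (fun k => toFunctionalCompletionLinear D k) -
      (evalGerm F).toLin.compMultilinearMap T
  have hU : ∀ f, U f ∈ (⊥ : Submodule ℝ (Germ (evalFilter F) ℝ)) := by
    apply U.mem_of_mem_nonneg
    intro f hf
    rw [Submodule.mem_bot]
    change hT.germExt D φ ι (fun k => toFunctionalCompletion D (φ k) (f k)) - evalGerm F (T f) = 0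
    rw [sub_eq_zero]
    set x : ∀ k, functionalCompletion D (φ k) := fun k => toFunctionalCompletion D (φ k) (f k)
    have he : ∀ k, 0 ≤ dominator x k ⊔ f k := fun k => (hf k).trans le_sup_right
    rw [hT.germExt_eq hs hι he fun k => le_sup_left]
    exact hT.localExt_toFunctionalCompletion hs hι hf he fun k => le_sup_right
  exact sub_eq_zero.1 ((Submodule.mem_bot ℝ).1 (hU f))

/-- On tuples from the `E k` the values are those of `T`. With the other coordinates fixed and
positive, the extension is a homomorphism in the remaining one, so `D`-completeness of `F` keeps its
values in `F`. -/
theorem IsVLMultimorphism.germExt_mem_range (hT : IsVLMultimorphism T) (hs : 1 ≤ s)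
    (hι : ∀ k x, ι k (φ k x) = evalGerm (E k) x) (hF : IsFunctionallyComplete D F)
    (x : ∀ k, functionalCompletion D (φ k)) :
    hT.germExt D φ ι x ∈ (evalGerm F).range := by
  refine (hT.germExtMultilinear hs hι D).mem_of_mem_generators (evalGerm F).range.toSubmodule
    (fun k => Set.range (toFunctionalCompletion D (φ k))) ?_ ?_ ?_ x
  · rintro k _ ⟨a, rfl⟩
    exact ⟨⟨_, (toFunctionalCompletion_posPart D k a).symm⟩,
      ⟨_, (toFunctionalCompletion_negPart D k a).symm⟩⟩
  · intro x hx
    choose f hf using hx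
    obtain rfl : (fun k => toFunctionalCompletion D (φ k) (f k)) = x := funext hf
    exact ⟨T f, (hT.germExt_toFunctionalCompletion hs hι f).symm⟩
  · intro k x hx hk b
    exact mem_range_of_mem_range hF (evalGerm F)
      ⟨_, hT.isLatticeHom_germExtMultilinear hs hι D hx k⟩ (fun a => hk _ ⟨a, rfl⟩) b

theorem IsVLMultimorphism.exists_extension (hT : IsVLMultimorphism T) (hs : 1 ≤ s)
    (hι : ∀ k x, ι k (φ k x) = evalGerm (E k) x) (hF : IsFunctionallyComplete D F) :
    ∃ S : MultilinearMap ℝ (fun k => functionalCompletion D (φ k)) F, IsVLMultimorphism S ∧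
      ∀ f : ∀ k, E k, S (fun k => toFunctionalCompletion D (φ k) (f k)) = T f := by
  let U := hT.germExtMultilinear hs hι D
  have hU : ∀ x, ∃ y, evalGerm F y = U x := fun x => hT.germExt_mem_range hs hι hF x
  choose S hS using hU
  refine ⟨⟨S, ?_, ?_⟩, ?_, ?_⟩
  · intro inst x i a b
    apply evalGerm_injective
    rw [VLHom.map_add, hS, hS, hS, U.map_update_add]
  · intro inst x i r a
    apply evalGerm_injective
    rw [VLHom.map_smul, hS, hS, U.map_update_smul]
  · intro k x hx a b
    -- The coordinate `x k` has no prescribed sign; it is overwritten anyway, so zero is put in its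
    -- place.
    have hx' : ∀ j, 0 ≤ Function.update x k 0 j := by
      intro j
      by_cases hj : j = k
      · subst hj; simp
      · rw [Function.update_of_ne hj]; exact hx j hj
    have hlat := hT.isLatticeHom_germExtMultilinear hs hι D hx' k a b
    have hval : ∀ y, evalGerm F (S (Function.update x k y)) =
        U.toLinearMap (Function.update x k 0) k y := by
      intro y
      rw [hS, MultilinearMap.toLinearMap_apply, Function.update_idem]
    constructor
    · apply evalGerm_injective
      change evalGerm F (S _) = evalGerm F (S _ ⊔ S _)
      rw [VLHom.map_sup, hval, hval, hval]
      exact hlat.1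
    · apply evalGerm_injective
      change evalGerm F (S _) = evalGerm F (S _ ⊓ S _)
      rw [VLHom.map_inf, hval, hval, hval]
      exact hlat.2
  · intro f
    apply evalGerm_injective
    change evalGerm F (S _) = _
    rw [hS]
    exact hT.germExt_toFunctionalCompletion hs hι f

theorem eq_of_eq_on_toFunctionalCompletion
    {S S' : MultilinearMap ℝ (fun k => functionalCompletion D (φ k)) F}
    (hS : IsVLMultimorphism S) (hS' : IsVLMultimorphism S')
    (h : ∀ f : ∀ k, E k, S (fun k => toFunctionalCompletion D (φ k) (f k)) =
      S' (fun k => toFunctionalCompletion D (φ k) (f k))) : S = S' := by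
  ext x
  rw [← sub_eq_zero]
  refine (Submodule.mem_bot ℝ).1 ((S - S').mem_of_mem_generators ⊥
    (fun k => Set.range (toFunctionalCompletion D (φ k))) ?_ ?_ ?_ x)
  · rintro k _ ⟨a, rfl⟩
    exact ⟨⟨_, (toFunctionalCompletion_posPart D k a).symm⟩,
      ⟨_, (toFunctionalCompletion_negPart D k a).symm⟩⟩
  · intro x hx
    choose f hf using hx
    obtain rfl : (fun k => toFunctionalCompletion D (φ k) (f k)) = x := funext hf
    exact (Submodule.mem_bot ℝ).2 (sub_eq_zero.2 (h f))
  · intro k x hx hk b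
    have h1 : (evalGerm F).comp (hS.slice hx k) = (evalGerm F).comp (hS'.slice hx k) := by
      apply eq_of_eq_on_range
      intro y
      rw [VLHom.comp_apply, VLHom.comp_apply]
      exact congrArg _ (sub_eq_zero.1 ((Submodule.mem_bot ℝ).1 (hk _ ⟨y, rfl⟩)))
    have h2 := evalGerm_injective (DFunLike.congr_fun h1 b)
    exact (Submodule.mem_bot ℝ).2 (sub_eq_zero.2 h2)

end Extension

theorem existsUnique_extension_functionalCompletion {s : ℕ} (hs : 1 ≤ s) {E G : Fin s → Type u}
    [∀ k, AddCommGroup (E k)] [∀ k, Lattice (E k)] [∀ k, Module ℝ (E k)]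
    [∀ k, ArchimedeanVectorLattice (E k)]
    [∀ k, AddCommGroup (G k)] [∀ k, Lattice (G k)] [∀ k, Module ℝ (G k)]
    {F : Type v} [AddCommGroup F] [Lattice F] [Module ℝ F] [ArchimedeanVectorLattice F]
    {D : Set AnyPosHomFun} (hF : IsFunctionallyComplete D F)
    {T : MultilinearMap ℝ E F} (hT : IsVLMultimorphism T)
    {φ : ∀ k, VLHom (E k) (G k)} (hφ : ∀ k, IsUniformCompletion (φ k)) :
    ∃! S : MultilinearMap ℝ (fun k => functionalCompletion D (φ k)) F,
      IsVLMultimorphism S ∧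
      ∀ f : ∀ k, E k, S (fun k => toFunctionalCompletion D (φ k) (f k)) = T f := by
  have : ∀ k, ArchimedeanVectorLattice (G k) := fun k => (hφ k).archimedean
  -- The germs of `E k` are themselves uniformly complete and Archimedean, so the universal property
  -- maps any given completion into them over `E k`.
  choose ι hι _ using fun k =>
    (hφ k).existsUnique_extension _ (isUniformlyComplete_germ _) (evalGerm (E k))
  obtain ⟨S, hS, hST⟩ := hT.exists_extension hs hι hF
  exact ⟨S, ⟨hS, hST⟩, fun S' hS' => eq_of_eq_on_toFunctionalCompletion hS'.1 hS
    fun f => (hS'.2 f).trans (hST f).symm⟩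

theorem theorem3p18 {s : ℕ} (hs : 1 ≤ s) (E : Fin s → Type u)
    [∀ k, AddCommGroup (E k)] [∀ k, Lattice (E k)] [∀ k, Module ℝ (E k)]
    [∀ k, ArchimedeanVectorLattice (E k)]
    (F : Type v) [AddCommGroup F] [Lattice F] [Module ℝ F] [ArchimedeanVectorLattice F]
    (D : Set AnyPosHomFun) (hD : D.Nonempty) (hF : IsFunctionallyComplete D F)
    (T : MultilinearMap ℝ E F) (hT : IsVLMultimorphism T) :
    -- every `E k` has a uniform completion
    (∀ k, ∃ (G : Type u) (_ : AddCommGroup G) (_ : Lattice G) (_ : Module ℝ G)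
      (φ : VLHom (E k) G), IsUniformCompletion φ) ∧
    -- and, inside any uniform completions `G k` of the `E k`:
    ∀ (G : Fin s → Type u) [∀ k, AddCommGroup (G k)] [∀ k, Lattice (G k)] [∀ k, Module ℝ (G k)]
      (φ : ∀ k, VLHom (E k) (G k)), (∀ k, IsUniformCompletion (φ k)) →
      ((∀ h ∈ D, h.2.AbsolutelyInvariant) →
        ∃! S : MultilinearMap ℝ (fun k => functionalCompletion D (φ k)) F,
          IsVLMultimorphism S ∧
          ∀ f : ∀ k, E k, S (fun k => toFunctionalCompletion D (φ k) (f k)) = T f) ∧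
      (s = 1 →
        ∃! S : MultilinearMap ℝ (fun k => functionalCompletion D (φ k)) F,
          IsVLMultimorphism S ∧
          ∀ f : ∀ k, E k, S (fun k => toFunctionalCompletion D (φ k) (f k)) = T f) := 
  ⟨fun k => exists_isUniformCompletion (E k), fun _ _ _ _ _ hφ =>
    ⟨fun _ => existsUnique_extension_functionalCompletion hs hF hT hφ,
      fun _ => existsUnique_extension_functionalCompletion hs hF hT hφ⟩⟩
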